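/- **Setting.** Let $A$ be an integrally closed integral domain with field of fractions $K$, and let $H=\bigoplus_{i\in\mathbb Z}H_i$ be a $\mathbb Z$-graded associative $A$-algebra that is finitely generated and free as an $A$-module. For a commutative $A$-algebra $R$ put $RH:=R\otimes_A H$, graded by $(RH)_i=R\otimes_A H_i$. For a field $R$, let $\mathcal R_0(RH)$ be the Grothendieck group of finite-dimensional graded $RH$-modules, and $\mathcal R_0^+(RH)=\{[V]\}$ the subset of classes of graded modules. For a graded module $V$ let $V\langle j\rangle_i=V_{i-j}$; $\mathbb Z[q,q^{-1}]$ acts on $\mathcal R_0(RH)$ by $q^j[V]=[V\langle j\rangle]$. For each simple $RH$-module fix, up to isomorphism, one graded module $M$ with that underlying module; the set of these is denoted $\mathrm{Irr}(RH)$. The algebra $RH$ is split if $\mathrm{End}_{RH}(S)=R$ for every simple $RH$-module $S$. For a graded module $W$ and a simple graded module $M$, $[W:M]^{\mathrm{gr}}$ is the multiplicity of $M$ in a graded composition series of $W$. **Decomposition maps.** Let $C$ be an $A$-algebra that is an integrally closed domain with field of fractions $F$, and let $\sigma:C\to E$ be a homomorphism of $A$-algebras into a field $E$ which is the field of fractions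 of $\sigma(C)$, with $EH$ split. The graded decomposition map of $\sigma$ is the group homomorphism $d^{\mathrm{gr}}_\sigma:\mathcal R_0(FH)\to\mathcal R_0(EH)$, commuting with $q$ and mapping $\mathcal R_0^+(FH)$ into $\mathcal R_0^+(EH)$, such that $$d^{\mathrm{gr}}_\sigma([F\otimes_{\mathcal O}\widetilde V])=[k\otimes_{\mathcal O}\widetilde V]$$ for every valuation ring $\mathcal O$ with $C\subseteq\mathcal O\subseteq F$, field of fractions $F$ and $J(\mathcal O)\cap C=\ker\sigma$, and every graded $\mathcal OH$-lattice $\widetilde V$ (a graded $\mathcal OH$-module finitely generated and free over $\mathcal O$). Here $J(\mathcal O)$ is the maximal ideal of $\mathcal O$, $k=\mathcal O/J(\mathcal O)\supseteq E$, and $\mathcal R_0(EH)$ is identified with $\mathcal R_0(kH)$ via $[W]\mapsto[k\otimes_E W]$. The graded decomposition matrix of $\sigma$ is $$D^{\mathrm{gr}}_\sigma(q)=\Big(\sum_{n\in\mathbb Z}q^n\,[k\otimes_{\mathcal O}\widetilde V:k\otimes_E M\langle n\rangle]^{\mathrm{gr}}\Big)_{V\in\mathrm{Irr}(FH),\ M\in\mathrm{Irr}(EH)},$$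 with entries in $\mathbb N[q,q^{-1}]$, rows indexed by $V$ and columns by $M$, where $\widetilde V$ is a graded $\mathcal OH$-lattice with $F\otimes_{\mathcal O}\widetilde V\cong V$. **Proposition.** Let $\theta:A\to L$ and $\theta':A\to L'$ be ring homomorphisms into fields such that $L$ and $L'$ are the fields of fractions of $\theta(A)$ and $\theta'(A)$, and $\ker\theta\subseteq\ker\theta'$. Let $B$ be a ring with $\theta(A)\subseteq B\subseteq L$ that is integrally closed in $L$, and let $\varphi:B\to L'$ be a ring homomorphism with $\varphi\circ\theta=\theta'$. Assume that $LH$ and $L'H$ are split. Then the graded decomposition maps $d^{\mathrm{gr}}_\theta:\mathcal R_0(KH)\to\mathcal R_0(LH)$ and $d^{\mathrm{gr}}_{\theta'}:\mathcal R_0(KH)\to\mathcal R_0(L'H)$ of $\theta$ and $\theta'$, and $d^{\mathrm{gr}}_{\theta,\theta'}:\mathcal R_0(LH)\to\mathcal R_0(L'H)$ of $\varphi$, exist, are unique, and satisfy $$d^{\mathrm{gr}}_{\theta'}=d^{\mathrm{gr}}_{\theta,\theta'}\circ d^{\mathrm{gr}}_{\theta}.$$ Moreover, the associated graded decomposition matrices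 $D^{\mathrm{gr}}_\theta(q)$, $D^{\mathrm{gr}}_{\theta'}(q)$, $D^{\mathrm{gr}}_{\theta,\theta'}(q)$ exist and are well defined (independent of the choice of $\mathcal O$ and $\widetilde V$), $\mathrm{Irr}(LH)$ is finite, and $$D^{\mathrm{gr}}_{\theta'}(q)=D^{\mathrm{gr}}_{\theta}(q)\,D^{\mathrm{gr}}_{\theta,\theta'}(q).$$ -/

import Mathlib

open scoped TensorProduct LaurentPolynomial

universe u

/-! ### Graded modules over a graded algebra -/

section Graded

variable {R S : Type u} [CommRing R] [Ring S] [Algebra R S]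

/-- A graded module over the `ℤ`-graded `R`-algebra `S = ⨁ 𝒮 i`, finitely generated over the
base ring `R` (so finite-dimensional when `R` is a field): an `S`-module with a decomposition
into `R`-submodules `deg j` such that `𝒮 i • deg j ⊆ deg (i + j)`. -/
structure GrMod (𝒮 : ℤ → Submodule R S) : Type (u + 1) where
  carrier : Type u
  [addCommGroup : AddCommGroup carrier]
  [moduleBase : Module R carrier]
  [moduleAlg : Module S carrier]
  [tower : IsScalarTower R S carrier]
  [finite : Module.Finite R carrier]
  deg : ℤ → Submodule R carrier
  isInternal : DirectSum.IsInternal deg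
  smul_mem : ∀ (i j : ℤ) (s : S) (v : carrier), s ∈ 𝒮 i → v ∈ deg j → s • v ∈ deg (i + j)

attribute [instance] GrMod.addCommGroup GrMod.moduleBase GrMod.moduleAlg GrMod.tower GrMod.finite

namespace GrMod

variable {𝒮 : ℤ → Submodule R S}

/-- An `S`-linear map preserves degrees, i.e. is a morphism of graded modules. -/
def IsGrHom {V W : GrMod 𝒮} (f : V.carrier →ₗ[S] W.carrier) : Prop :=
  ∀ i, ∀ v ∈ V.deg i, f v ∈ W.deg i

/-- Isomorphism of graded modules: existence of a bijective morphism of graded modules. -/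
def Iso (V W : GrMod 𝒮) : Prop :=
  ∃ f : V.carrier →ₗ[S] W.carrier, IsGrHom f ∧ Function.Bijective f

/-- The underlying ungraded modules are isomorphic. -/
def UngradedIso (V W : GrMod 𝒮) : Prop :=
  Nonempty (V.carrier ≃ₗ[S] W.carrier)

/-- There is a short exact sequence `0 → V' → V → V'' → 0` of graded modules. -/
def IsExtension (V' V V'' : GrMod 𝒮) : Prop :=
  ∃ (f : V'.carrier →ₗ[S] V.carrier) (g : V.carrier →ₗ[S] V''.carrier),
    IsGrHom f ∧ IsGrHom g ∧
      Function.Injective f ∧ Function.Exact f g ∧ Function.Surjective g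

/-- An `S`-submodule is a graded submodule: it is spanned by its homogeneous elements. -/
def IsGrSubmodule (V : GrMod 𝒮) (N : Submodule S V.carrier) : Prop :=
  N.restrictScalars R ≤ ⨆ i, (N.restrictScalars R ⊓ V.deg i)

/-- Simple graded module: nonzero and without proper nonzero graded submodules. -/
def IsGrSimple (V : GrMod 𝒮) : Prop :=
  Nontrivial V.carrier ∧ ∀ N : Submodule S V.carrier, V.IsGrSubmodule N → N = ⊥ ∨ N = ⊤

/-- `HasGrCompFactors V l`: the graded module `V` has a graded composition series whose
successive factors (from the top) are the simple graded modules in the list `l`. -/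
inductive HasGrCompFactors : GrMod 𝒮 → List (GrMod 𝒮) → Prop
  | nil (V : GrMod 𝒮) (h : Subsingleton V.carrier) : HasGrCompFactors V []
  | cons (V' V M : GrMod 𝒮) (l : List (GrMod 𝒮)) (hM : M.IsGrSimple)
      (h : IsExtension V' V M) (hl : HasGrCompFactors V' l) : HasGrCompFactors V (M :: l)

open Classical in
/-- `IsGrMultiplicity V M m`: the simple graded module `M` occurs `m` times, up to isomorphism of
graded modules, in a graded composition series of `V`, i.e. `[V : M]^gr = m`. -/
def IsGrMultiplicity (V M : GrMod 𝒮) (m : ℕ) : Prop :=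
  M.IsGrSimple ∧ ∃ l : List (GrMod 𝒮), HasGrCompFactors V l ∧ l.countP (fun N => Iso N M) = m

/-- The shift `V⟨j⟩`, with `V⟨j⟩_i = V_{i-j}`. -/
def shift (V : GrMod 𝒮) (j : ℤ) : GrMod 𝒮 where
  carrier := V.carrier
  deg i := V.deg (i - j)
  isInternal := by
    have h := (DirectSum.isInternal_submodule_iff_iSupIndep_and_iSup_eq_top V.deg).1 V.isInternal
    refine (DirectSum.isInternal_submodule_iff_iSupIndep_and_iSup_eq_top _).2
      ⟨h.1.comp (Equiv.subRight j).injective, ?_⟩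
    rw [← h.2]
    exact (Equiv.subRight j).iSup_comp (g := V.deg)
  smul_mem i k s v hs hv := by
    have h := V.smul_mem i (k - j) s v hs hv
    rwa [← add_sub_assoc] at h

end GrMod

/-! ### The graded Grothendieck group -/

/-- The relations `[V] = [V'] + [V'']`, one for each short exact sequence of graded modules. -/
def grRelations (𝒮 : ℤ → Submodule R S) : Set (FreeAbelianGroup (GrMod 𝒮)) :=
  {x | ∃ V' V V'' : GrMod 𝒮, GrMod.IsExtension V' V V'' ∧
    x = FreeAbelianGroup.of V - (FreeAbelianGroup.of V' + FreeAbelianGroup.of V'')}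

/-- The Grothendieck group `R₀` of the category of finite graded `S`-modules. -/
abbrev GrK0 (𝒮 : ℤ → Submodule R S) : Type (u + 1) :=
  FreeAbelianGroup (GrMod 𝒮) ⧸ AddSubgroup.closure (grRelations 𝒮)

namespace GrK0

variable {𝒮 : ℤ → Submodule R S}

/-- The class `[V]`. -/
def cls (V : GrMod 𝒮) : GrK0 𝒮 := QuotientAddGroup.mk (FreeAbelianGroup.of V)

/-- The subset `R₀⁺` of classes of graded modules. -/
def positive (𝒮 : ℤ → Submodule R S) : Set (GrK0 𝒮) := Set.range cls

theorem cls_eq_add {V' V V'' : GrMod 𝒮} (h : GrMod.IsExtension V' V V'') :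
    cls V = cls V' + cls V'' := by
  have h1 : (QuotientAddGroup.mk (FreeAbelianGroup.of V -
      (FreeAbelianGroup.of V' + FreeAbelianGroup.of V'')) : GrK0 𝒮) = 0 :=
    (QuotientAddGroup.eq_zero_iff _).2 (AddSubgroup.subset_closure ⟨V', V, V'', h, rfl⟩)
  exact sub_eq_zero.1 h1

/-- The homomorphism induced on `R₀` by an assignment additive on short exact sequences. -/
def lift {G : Type*} [AddCommGroup G] (F : GrMod 𝒮 → G)
    (hF : ∀ V' V V'' : GrMod 𝒮, GrMod.IsExtension V' V V'' → F V = F V' + F V'') :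
    GrK0 𝒮 →+ G :=
  QuotientAddGroup.lift _ (FreeAbelianGroup.lift F) (by
    rw [AddSubgroup.closure_le]
    rintro x ⟨V', V, V'', h, rfl⟩
    simp [AddMonoidHom.mem_ker, hF _ _ _ h])

@[simp] theorem lift_cls {G : Type*} [AddCommGroup G] (F : GrMod 𝒮 → G)
    (hF : ∀ V' V V'' : GrMod 𝒮, GrMod.IsExtension V' V V'' → F V = F V' + F V'')
    (V : GrMod 𝒮) : lift F hF (cls V) = F V := by
  simp [lift, cls]

/-- The action of `q ^ j` on `R₀`, induced by `V ↦ V⟨j⟩`. -/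
def qPow (j : ℤ) : GrK0 𝒮 →+ GrK0 𝒮 :=
  lift (fun V => cls (V.shift j)) (by
    rintro V' V V'' ⟨f, g, hf, hg, h⟩
    exact cls_eq_add ⟨f, g, fun i => hf (i - j), fun i => hg (i - j), h⟩)

end GrK0

/-- The `R`-algebra `S` (over a field `R`) is split: every endomorphism of a simple `S`-module is
multiplication by a scalar of `R`. -/
def IsSplitAlgebra (R S : Type u) [Field R] [Ring S] [Algebra R S] : Prop :=
  ∀ (M : Type u) [AddCommGroup M] [Module R M] [Module S M] [IsScalarTower R S M],
    IsSimpleModule S M → ∀ f : M →ₗ[S] M, ∃ c : R, ∀ m : M, f m = c • m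

/-- `M : ι → GrMod 𝒮` is a choice of one graded module for each isomorphism class of simple
ungraded `S`-modules: the underlying modules of the `M i` are simple, pairwise non-isomorphic, and
every simple `S`-module is isomorphic to one of them. -/
structure IsGrIrrSystem {𝒮 : ℤ → Submodule R S} {ι : Type*} (M : ι → GrMod 𝒮) : Prop where
  simple : ∀ i, IsSimpleModule S (M i).carrier
  unique : ∀ i j, GrMod.UngradedIso (M i) (M j) → i = j
  exhaust : ∀ (N : Type u) [AddCommGroup N] [Module S N],
    IsSimpleModule S N → ∃ i, Nonempty (N ≃ₗ[S] (M i).carrier)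

end Graded

/-! ### Scalar extension -/

section BaseChange

variable {A H : Type u} [CommRing A] [Ring H] [Algebra A H]

/-- Graded `RH`-modules, where `RH = R ⊗[A] H` is graded by `(RH)_i = R (1 ⊗ H_i)`. -/
abbrev GrModOver (ℋ : ℤ → Submodule A H) (R : Type u) [CommRing R] [Algebra A R] : Type (u + 1) :=
  GrMod (R := R) (S := R ⊗[A] H) (fun i => (ℋ i).baseChange R)

/-- The Grothendieck group `R₀(RH)` of graded `RH`-modules. -/
abbrev GrK0Over (ℋ : ℤ → Submodule A H) (R : Type u) [CommRing R] [Algebra A R] : Type (u + 1) :=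
  GrK0 (R := R) (S := R ⊗[A] H) (fun i => (ℋ i).baseChange R)

section

variable (R H : Type u) [Ring H] [Algebra A H] [CommRing R] [Algebra A R]
  (R' : Type u) [CommRing R'] [Algebra A R'] [Algebra R R'] [IsScalarTower A R R']

/-- The canonical homomorphism of `R'`-algebras `R'H → R' ⊗[R] RH`, `a ⊗ h ↦ a ⊗ (1 ⊗ h)`. -/
noncomputable def baseChangeAlg :
    (R' ⊗[A] H) →ₐ[R'] (R' ⊗[R] (R ⊗[A] H)) :=
  Algebra.TensorProduct.lift Algebra.TensorProduct.includeLeft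
    (((Algebra.TensorProduct.includeRight :
      (R ⊗[A] H) →ₐ[R] R' ⊗[R] (R ⊗[A] H)).restrictScalars A).comp
      Algebra.TensorProduct.includeRight)
    (fun a h => by
      change Commute (a ⊗ₜ[R] (1 : R ⊗[A] H)) ((1 : R') ⊗ₜ[R] ((1 : R) ⊗ₜ[A] h))
      simp [Commute, SemiconjBy])

variable (V : Type u) [AddCommGroup V] [Module R V] [Module (R ⊗[A] H) V]
  [IsScalarTower R (R ⊗[A] H) V]

/-- The representation of `R'H` on `R' ⊗[R] V` afforded by an `RH`-module `V`. -/
noncomputable def baseChangeRep : (R' ⊗[A] H) →ₐ[R'] Module.End R' (R' ⊗[R] V) :=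
  (Algebra.TensorProduct.lift (Algebra.ofId R' (Module.End R' (R' ⊗[R] V)))
    ((Module.End.baseChangeHom R R' V).comp (Algebra.lsmul R R V : (R ⊗[A] H) →ₐ[R] _))
    (fun r _ => by
      rw [Algebra.ofId_apply]; exact Algebra.commute_algebraMap_left r _)).comp
    (baseChangeAlg (A := A) R H R')

theorem baseChangeRep_tmul (a b : R') (h : H) (v : V) :
    baseChangeRep R H R' V (a ⊗ₜ[A] h) (b ⊗ₜ[R] v) = (a * b) ⊗ₜ[R] (((1 : R) ⊗ₜ[A] h) • v) := by
  have h1 : baseChangeAlg (A := A) R H R' (a ⊗ₜ[A] h) = a ⊗ₜ[R] ((1 : R) ⊗ₜ[A] h) := by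
    rw [baseChangeAlg, Algebra.TensorProduct.lift_tmul]
    change (a ⊗ₜ[R] (1 : R ⊗[A] H)) * ((1 : R') ⊗ₜ[R] ((1 : R) ⊗ₜ[A] h)) = _
    rw [Algebra.TensorProduct.tmul_mul_tmul, mul_one, one_mul]
  rw [baseChangeRep, AlgHom.comp_apply, h1, Algebra.TensorProduct.lift_tmul]
  change a • ((LinearMap.baseChange R' (Algebra.lsmul R R V ((1 : R) ⊗ₜ[A] h))) (b ⊗ₜ[R] v)) = _
  rw [LinearMap.baseChange_tmul, TensorProduct.smul_tmul', smul_eq_mul]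
  rfl

variable {R H V} in
theorem baseChangeRep_map {W : Type u} [AddCommGroup W] [Module R W] [Module (R ⊗[A] H) W]
    [IsScalarTower R (R ⊗[A] H) W] (f : V →ₗ[R ⊗[A] H] W) (x : R' ⊗[A] H) (y : R' ⊗[R] V) :
    (f.restrictScalars R).baseChange R' (baseChangeRep R H R' V x y) =
      baseChangeRep R H R' W x ((f.restrictScalars R).baseChange R' y) := by
  induction x using TensorProduct.induction_on with
  | zero => simp
  | add x x' hx hx' => simp only [map_add, LinearMap.add_apply, hx, hx']
  | tmul a h =>
    induction y using TensorProduct.induction_on with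
    | zero => simp
    | add y y' hy hy' => simp only [map_add, hy, hy']
    | tmul b v => simp [baseChangeRep_tmul]

variable {R} in
theorem map_mem_baseChange {V W : Type u} [AddCommGroup V] [Module R V] [AddCommGroup W]
    [Module R W] {p : Submodule R V} {q : Submodule R W} (f : V →ₗ[R] W)
    (hf : ∀ v ∈ p, f v ∈ q) (v : R' ⊗[R] V) (hv : v ∈ p.baseChange R') :
    f.baseChange R' v ∈ q.baseChange R' := by
  rw [Submodule.baseChange_eq_span] at hv
  induction hv using Submodule.span_induction with
  | zero => simp
  | add x y _ _ hx hy => rw [map_add]; exact add_mem hx hy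
  | smul a x _ hx => rw [map_smul]; exact Submodule.smul_mem _ _ hx
  | mem x hx =>
    obtain ⟨w, hw, rfl⟩ := hx
    exact Submodule.tmul_mem_baseChange_of_mem _ (hf w hw)

variable {R H R' V} in
theorem baseChangeRep_mem {N : Submodule A H} {p q : Submodule R V}
    (hpq : ∀ s ∈ N.baseChange R, ∀ v ∈ p, s • v ∈ q)
    {s : R' ⊗[A] H} (hs : s ∈ N.baseChange R') {v : R' ⊗[R] V} (hv : v ∈ p.baseChange R') :
    baseChangeRep R H R' V s v ∈ q.baseChange R' := by
  rw [Submodule.baseChange_eq_span] at hs hv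
  induction hs using Submodule.span_induction with
  | zero => simp
  | add x y _ _ hx hy => rw [map_add, LinearMap.add_apply]; exact add_mem hx hy
  | smul a x _ hx => rw [map_smul, LinearMap.smul_apply]; exact Submodule.smul_mem _ _ hx
  | mem x hx =>
    obtain ⟨h, hh, rfl⟩ := hx
    induction hv using Submodule.span_induction with
    | zero => simp
    | add x y _ _ hx hy => rw [map_add]; exact add_mem hx hy
    | smul a x _ hx => rw [map_smul]; exact Submodule.smul_mem _ _ hx
    | mem y hy =>
      obtain ⟨w, hw, rfl⟩ := hy
      simp only [TensorProduct.mk_apply, baseChangeRep_tmul]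
      exact Submodule.tmul_mem_baseChange_of_mem _
        (hpq _ (Submodule.tmul_mem_baseChange_of_mem _ hh) _ hw)

end

namespace GrMod

variable {ℋ : ℤ → Submodule A H} {R : Type u} [CommRing R] [Algebra A R]

/-- The graded `R'H`-module `R' ⊗[R] V`, with `(a ⊗ h) • (b ⊗ v) = a b ⊗ h v` and with
homogeneous components `R' ⊗ V_i`. -/
noncomputable def baseChange (V : GrModOver ℋ R)
    (R' : Type u) [CommRing R'] [Algebra A R'] [Algebra R R'] [IsScalarTower A R R'] :
    GrModOver ℋ R' where
  carrier := R' ⊗[R] V.carrier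
  moduleAlg := Module.compHom (R' ⊗[R] V.carrier) (baseChangeRep R H R' V.carrier).toRingHom
  tower := by
    let _ : Module (R' ⊗[A] H) (R' ⊗[R] V.carrier) :=
      Module.compHom (R' ⊗[R] V.carrier) (baseChangeRep R H R' V.carrier).toRingHom
    exact ⟨fun a x y => DFunLike.congr_fun (map_smul (baseChangeRep R H R' V.carrier) a x) y⟩
  deg i := (V.deg i).baseChange R'
  isInternal := DirectSum.IsInternal.baseChange _ V.isInternal
  smul_mem i j _ _ hs hv := baseChangeRep_mem (fun s hs v hv => V.smul_mem i j s v hs hv) hs hv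

/-- Base change of an `RH`-linear map. -/
noncomputable def baseChangeMap {V W : GrModOver ℋ R}
    (f : V.carrier →ₗ[R ⊗[A] H] W.carrier)
    (R' : Type u) [CommRing R'] [Algebra A R'] [Algebra R R'] [IsScalarTower A R R'] :
    (V.baseChange R').carrier →ₗ[R' ⊗[A] H] (W.baseChange R').carrier where
  toFun := (f.restrictScalars R).baseChange R'
  map_add' := map_add ((f.restrictScalars R).baseChange R')
  map_smul' x y := baseChangeRep_map R' f x y

theorem IsExtension.baseChange {V' V V'' : GrModOver ℋ R} (h : IsExtension V' V V'')
    (R' : Type u) [CommRing R'] [Algebra A R'] [Algebra R R'] [IsScalarTower A R R']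
    [Module.Flat R R'] :
    IsExtension (V'.baseChange R') (V.baseChange R') (V''.baseChange R') := by
  obtain ⟨f, g, hf, hg, h1, h2, h3⟩ := h
  refine ⟨baseChangeMap f R', baseChangeMap g R',
    fun i => map_mem_baseChange R' (f.restrictScalars R) (hf i),
    fun i => map_mem_baseChange R' (g.restrictScalars R) (hg i), ?_, ?_, ?_⟩
  · exact Module.Flat.lTensor_preserves_injective_linearMap (M := R') (f.restrictScalars R) h1
  · exact lTensor_exact R' (f := f.restrictScalars R) (g := g.restrictScalars R) h2 h3
  · exact LinearMap.lTensor_surjective R' (g := g.restrictScalars R) h3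

end GrMod

/-- The canonical map `R₀(RH) → R₀(R'H)`, `[V] ↦ [R' ⊗[R] V]`, for `R'` flat over `R`
(for instance a field extension). -/
noncomputable def GrK0.baseChange {ℋ : ℤ → Submodule A H} {R : Type u} [CommRing R] [Algebra A R]
    (R' : Type u) [CommRing R'] [Algebra A R'] [Algebra R R'] [IsScalarTower A R R']
    [Module.Flat R R'] : GrK0Over ℋ R →+ GrK0Over ℋ R' :=
  GrK0.lift (fun V => GrK0.cls (GrMod.baseChange V R'))
    (fun _ _ _ h => GrK0.cls_eq_add (h.baseChange R'))

end BaseChange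

/-! ### Modular reduction and the graded decomposition map -/

section Decomposition

/-- For a specialization `σ : C → L` of an `A`-algebra `C` with field of fractions `K`: a
valuation ring `O` with `C ⊆ O ⊆ K`, with field of fractions `K`, such that
`J(O) ∩ C = ker σ`, together with the resulting embedding of `L` (the field of fractions of `σ(C)`)
into the residue field of `O`. -/
structure ModularSystem (A C K L : Type u) [CommRing A] [CommRing C] [Algebra A C]
    [Field K] [Algebra A K] [Algebra C K] [Field L] [Algebra A L] (σ : C →ₐ[A] L) where
  O : Type u
  [commRing : CommRing O]
  [isDomain : IsDomain O]
  [valuationRing : ValuationRing O]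
  [algA : Algebra A O]
  [algK : Algebra O K]
  [towerK : IsScalarTower A O K]
  [isFractionRing : IsFractionRing O K]
  incl : C →ₐ[A] O
  incl_spec : ∀ c, algebraMap O K (incl c) = algebraMap C K c
  mem_maximalIdeal_iff : ∀ c, incl c ∈ IsLocalRing.maximalIdeal O ↔ σ c = 0
  [algL : Algebra L (IsLocalRing.ResidueField O)]
  [towerL : IsScalarTower A L (IsLocalRing.ResidueField O)]
  residue_incl : ∀ c, IsLocalRing.residue O (incl c) =
    algebraMap L (IsLocalRing.ResidueField O) (σ c)

attribute [instance] ModularSystem.commRing ModularSystem.isDomain ModularSystem.valuationRing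
  ModularSystem.algA ModularSystem.algK ModularSystem.towerK ModularSystem.isFractionRing
  ModularSystem.algL ModularSystem.towerL

/-- The residue field of the valuation ring. -/
abbrev ModularSystem.k {A C K L : Type u} [CommRing A] [CommRing C] [Algebra A C]
    [Field K] [Algebra A K] [Algebra C K] [Field L] [Algebra A L] {σ : C →ₐ[A] L}
    (s : ModularSystem A C K L σ) : Type u :=
  IsLocalRing.ResidueField s.O

variable {A H : Type u} [CommRing A] [Ring H] [Algebra A H] (ℋ : ℤ → Submodule A H)
  {C K L : Type u} [CommRing C] [Algebra A C] [Field K] [Algebra A K] [Algebra C K]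
  [Field L] [Algebra A L]

/-- `d : R₀(KH) → R₀(LH)` is the graded decomposition map of the specialization `σ : C → L`, where
`K` is the field of fractions of `C`: it is a homomorphism of groups, compatible with the action
of `q`, that restricts to a map `R₀⁺(KH) → R₀⁺(LH)` and satisfies `d [K ⊗ Ṽ] = [k ⊗ Ṽ]` for every
graded `OH`-lattice `Ṽ`, where `R₀(LH)` is compared with `R₀(kH)` through `[W] ↦ [k ⊗ W]`. -/
structure IsGrDecompositionMap (σ : C →ₐ[A] L) (d : GrK0Over ℋ K →+ GrK0Over ℋ L) : Prop where
  map_positive : ∀ x ∈ GrK0.positive (fun i => (ℋ i).baseChange K),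
    d x ∈ GrK0.positive (fun i => (ℋ i).baseChange L)
  map_qPow : ∀ (j : ℤ) (x : GrK0Over ℋ K), d (GrK0.qPow j x) = GrK0.qPow j (d x)
  reduction : ∀ (s : ModularSystem A C K L σ) (V : GrModOver ℋ s.O),
    Module.Free s.O V.carrier →
      GrK0.baseChange s.k (d (GrK0.cls (V.baseChange K))) = GrK0.cls (V.baseChange s.k)

/-- `D` is the graded decomposition matrix of the specialization `σ : C → L`, with respect to the
graded modules `VK i` and `VL j` chosen for the simple `KH`- and `LH`-modules: whenever `V` is a
graded `OH`-lattice with `K ⊗ V ≅ VK i`, the coefficient of `q ^ n` in the entry `D i j`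
is the multiplicity of `(VL j)⟨n⟩`, extended to `k`, in the modular reduction `k ⊗ V`. -/
def IsGrDecompositionMatrix (σ : C →ₐ[A] L) {ιK ιL : Type*} (VK : ιK → GrModOver ℋ K)
    (VL : ιL → GrModOver ℋ L) (D : Matrix ιK ιL ℕ[T;T⁻¹]) : Prop :=
  ∀ (s : ModularSystem A C K L σ) (i : ιK) (j : ιL) (V : GrModOver ℋ s.O),
    Module.Free s.O V.carrier → GrMod.Iso (V.baseChange K) (VK i) →
      ∀ n : ℤ, GrMod.IsGrMultiplicity (V.baseChange s.k) (((VL j).shift n).baseChange s.k)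
        ((D i j).coeff n)

end Decomposition

/-! To a graded module `V` over a field attach, for every `x` in `H` and every degree `i`, the
characteristic polynomial `cp` of the operator `v ↦ x • v_i`, where `v_i` is the component of degree
`i`. It is multiplicative in short exact sequences (`IsExtension.cp_eq_mul`) and compatible with
base change (`cp_baseChange`).

Over a split algebra these polynomials determine the class of `V`. By Burnside's theorem each simple
`M j` has an element of `H` of degree zero and a scalar that is a simple eigenvalue in one degree of
`M j`, and is not an eigenvalue in any other degree or on any other simple module
(`IsGrIrrSystem.exists_elt`). Its root multiplicity in the polynomials of `V` counts the factors `(M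
j)⟨n⟩`.

A lattice over a valuation ring `O` puts the coefficients of `cp` in `O`. An integrally closed ring
is the intersection of the valuation rings above it, so the coefficients lie in `C`
(`GrMod.exists_map_eq_cp`). Reducing any lattice over any admissible `O` applies `σ` to them
(`ModularSystem.map_eq_cp`). Hence the class of the reduction depends only on `V`. It descends from
`k` to `L` because the simple modules of a split algebra stay simple over `k` and exhaust the simple
modules there (`TestSystem.exists_descent`). This yields the decomposition map and matrix.

Transitivity is then the identity `φ ∘ θ = θ'` applied to polynomials over `A`; valuation rings
never have to be composed. -/

/-! ### Characteristic polynomials in short exact sequences. -/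

/-- A linear section of `g` identifies `V` with `V' × V''`, where `a` becomes block upper triangular
with diagonal blocks `a'` and `a''`. -/
theorem LinearMap.charpoly_eq_mul_of_exact {F V' V V'' : Type*} [Field F]
    [AddCommGroup V'] [Module F V'] [Module.Finite F V'] [AddCommGroup V] [Module F V]
    [Module.Finite F V] [AddCommGroup V''] [Module F V''] [Module.Finite F V'']
    {f : V' →ₗ[F] V} {g : V →ₗ[F] V''} (hf : Function.Injective f) (hfg : Function.Exact f g)
    (hg : Function.Surjective g) {a' : V' →ₗ[F] V'} {a : V →ₗ[F] V} {a'' : V'' →ₗ[F] V''}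
    (h1 : ∀ x, a (f x) = f (a' x)) (h2 : ∀ x, g (a x) = a'' (g x)) :
    a.charpoly = a'.charpoly * a''.charpoly := by
  obtain ⟨s, hs⟩ := g.exists_rightInverse_of_surjective (LinearMap.range_eq_top.2 hg)
  have hs' : ∀ y, g (s y) = y := fun y => LinearMap.congr_fun hs y
  have hgf : ∀ x, g (f x) = 0 := fun x => (hfg _).2 ⟨x, rfl⟩
  let e : (V' × V'') ≃ₗ[F] V := LinearEquiv.ofBijective (f.coprod s) (by
    constructor
    · rw [injective_iff_map_eq_zero]
      rintro ⟨x, y⟩ hxy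
      simp only [LinearMap.coprod_apply] at hxy
      have hy : y = 0 := by
        have := congrArg g hxy
        simpa [hgf, hs'] using this
      subst hy
      simpa using hf (by simpa using hxy : f x = f 0)
    · intro v
      obtain ⟨x, hx⟩ := (hfg (v - s (g v))).1 (by simp [hs'])
      exact ⟨(x, g v), by simp [hx]⟩)
  have he : ∀ x y, e (x, y) = f x + s y := fun x y => rfl
  have hge : ∀ p, g (e p) = p.2 := fun p => by
    rw [← Prod.mk.eta (p := p), he]; simp [hgf, hs']
  let b' := Module.finBasis F V'
  let b'' := Module.finBasis F V''
  rw [← LinearMap.charpoly_toMatrix a ((b'.prod b'').map e), ← LinearMap.charpoly_toMatrix a' b',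
    ← LinearMap.charpoly_toMatrix a'' b'', ← Matrix.charpoly_fromBlocks_zero₂₁ _
      (Matrix.of fun i j => b'.repr (e.symm (a (s (b'' j)))).1 i)]
  congr 1
  have hl : ∀ x, e.symm (a (f x)) = (a' x, 0) := fun x => by
    rw [LinearEquiv.symm_apply_eq, he, h1]; simp
  have hr : ∀ y, (e.symm (a (s y))).2 = a'' y := fun y => by
    rw [← hge, LinearEquiv.apply_symm_apply, h2, hs']
  ext (i | i) (j | j) <;>
    simp [LinearMap.toMatrix_apply, he, hl, hr]

/-! ### Graded modules: projections, submodules, quotients and simplicity. -/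

namespace GrMod

section Basic

variable {R S : Type u} [CommRing R] [Ring S] [Algebra R S] {𝒮 : ℤ → Submodule R S}

/-- The projection of a graded module onto its component of degree `i`. -/
noncomputable def proj (V : GrMod 𝒮) (i : ℤ) : V.carrier →ₗ[R] V.carrier :=
  (V.deg i).subtype ∘ₗ DirectSum.component R ℤ (fun i => V.deg i) i ∘ₗ
    (LinearEquiv.ofBijective (DirectSum.coeLinearMap V.deg) V.isInternal).symm.toLinearMap

theorem proj_mem (V : GrMod 𝒮) (i : ℤ) (v : V.carrier) : V.proj i v ∈ V.deg i :=
  Subtype.property _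

theorem symm_apply_of_mem (V : GrMod 𝒮) {i : ℤ} {v : V.carrier} (hv : v ∈ V.deg i) :
    (LinearEquiv.ofBijective (DirectSum.coeLinearMap V.deg) V.isInternal).symm v =
      DirectSum.lof R ℤ (fun i => V.deg i) i ⟨v, hv⟩ :=
  (LinearEquiv.symm_apply_eq _).2 (DirectSum.coeLinearMap_lof V.deg i ⟨v, hv⟩).symm

theorem proj_same (V : GrMod 𝒮) {i : ℤ} {v : V.carrier} (hv : v ∈ V.deg i) :
    V.proj i v = v := by
  simp [proj, V.symm_apply_of_mem hv, DirectSum.component.lof_self]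

theorem proj_ne (V : GrMod 𝒮) {i j : ℤ} {v : V.carrier} (hv : v ∈ V.deg i) (hij : i ≠ j) :
    V.proj j v = 0 := by
  simp only [proj, LinearMap.comp_apply, LinearEquiv.coe_coe, V.symm_apply_of_mem hv,
    DirectSum.component.of]
  simp [hij]

theorem homogeneous_induction (V : GrMod 𝒮) {p : V.carrier → Prop}
    (hom : ∀ i, ∀ v ∈ V.deg i, p v) (add : ∀ v w, p v → p w → p (v + w)) (v : V.carrier) :
    p v := by
  have h := (DirectSum.isInternal_submodule_iff_iSupIndep_and_iSup_eq_top V.deg).1 V.isInternal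
  exact Submodule.iSup_induction V.deg (motive := p) (h.2 ▸ Submodule.mem_top) hom
    (hom 0 0 (zero_mem _)) add

theorem linearMap_ext_homogeneous (V : GrMod 𝒮) {M : Type*} [AddCommGroup M] [Module R M]
    {f g : V.carrier →ₗ[R] M} (h : ∀ i, ∀ v ∈ V.deg i, f v = g v) : f = g :=
  LinearMap.ext (V.homogeneous_induction h fun v w hv hw => by rw [map_add, map_add, hv, hw])

theorem proj_proj_same (V : GrMod 𝒮) (i : ℤ) (v : V.carrier) :
    V.proj i (V.proj i v) = V.proj i v := V.proj_same (V.proj_mem i v)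

theorem proj_proj_ne (V : GrMod 𝒮) {i j : ℤ} (h : i ≠ j) (v : V.carrier) :
    V.proj j (V.proj i v) = 0 := V.proj_ne (V.proj_mem i v) h

theorem exists_support_elt (V : GrMod 𝒮) (v : V.carrier) :
    ∃ s : Finset ℤ, ∀ i ∉ s, V.proj i v = 0 := by
  classical
  induction v using V.homogeneous_induction with
  | hom i v hv => exact ⟨{i}, fun j hj => V.proj_ne hv fun h => hj (by simp [h])⟩
  | add v w hv hw =>
    obtain ⟨s, hs⟩ := hv
    obtain ⟨t, ht⟩ := hw
    refine ⟨s ∪ t, fun i hi => ?_⟩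
    rw [Finset.mem_union, not_or] at hi
    rw [map_add, hs i hi.1, ht i hi.2, add_zero]

theorem exists_support (V : GrMod 𝒮) : ∃ s : Finset ℤ, ∀ i ∉ s, V.proj i = 0 := by
  classical
  obtain ⟨t, ht⟩ := Module.Finite.fg_top (R := R) (M := V.carrier)
  choose s hs using V.exists_support_elt
  refine ⟨t.biUnion s, fun i hi => LinearMap.ext_on ht fun v hv => hs v i fun h => hi ?_⟩
  exact Finset.mem_biUnion.2 ⟨v, hv, h⟩

theorem sum_proj (V : GrMod 𝒮) {s : Finset ℤ} (hs : ∀ i ∉ s, V.proj i = 0) (v : V.carrier) :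
    ∑ i ∈ s, V.proj i v = v := by
  classical
  induction v using V.homogeneous_induction with
  | add v w hv hw => simp only [map_add, Finset.sum_add_distrib, hv, hw]
  | hom i v hv =>
    rw [Finset.sum_eq_single i (fun j _ hj => V.proj_ne hv hj.symm)]
    · exact V.proj_same hv
    · intro hi; rw [hs i hi, LinearMap.zero_apply]

theorem ext_proj (V : GrMod 𝒮) {v w : V.carrier} (h : ∀ i, V.proj i v = V.proj i w) : v = w := by
  obtain ⟨s, hs⟩ := V.exists_support
  rw [← V.sum_proj hs v, ← V.sum_proj hs w]
  exact Finset.sum_congr rfl fun i _ => h i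

theorem proj_smul (V : GrMod 𝒮) {d : ℤ} {s : S} (hs : s ∈ 𝒮 d) (i : ℤ) (v : V.carrier) :
    V.proj (d + i) (s • v) = s • V.proj i v := by
  induction v using V.homogeneous_induction with
  | add v w hv hw => simp only [smul_add, map_add, hv, hw]
  | hom j v hv =>
    have h := V.smul_mem d j s v hs hv
    by_cases hij : j = i
    · subst hij; rw [V.proj_same h, V.proj_same hv]
    · rw [V.proj_ne h (by lia), V.proj_ne hv hij, smul_zero]

theorem IsGrHom.map_proj {V W : GrMod 𝒮} {f : V.carrier →ₗ[S] W.carrier} (hf : IsGrHom f)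
    (i : ℤ) (v : V.carrier) : f (V.proj i v) = W.proj i (f v) := by
  induction v using V.homogeneous_induction with
  | add v w hv hw => simp only [map_add, hv, hw]
  | hom j v hv =>
    by_cases hij : j = i
    · subst hij; rw [V.proj_same hv, W.proj_same (hf _ _ hv)]
    · rw [V.proj_ne hv hij, W.proj_ne (hf _ _ hv) hij, map_zero]

theorem isGrSubmodule_iff {V : GrMod 𝒮} {N : Submodule S V.carrier} :
    V.IsGrSubmodule N ↔ ∀ i, ∀ v ∈ N, V.proj i v ∈ N := by
  constructor
  · intro h i v hv
    refine Submodule.iSup_induction _ (motive := fun v => V.proj i v ∈ N) (h hv) ?_ ?_ ?_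
    · rintro j w ⟨hw, hwj⟩
      by_cases hij : j = i
      · subst hij; rw [V.proj_same hwj]; exact hw
      · rw [V.proj_ne hwj hij]; exact zero_mem _
    · rw [map_zero]; exact zero_mem _
    · intro x y hx hy; rw [map_add]; exact add_mem hx hy
  · intro h v hv
    obtain ⟨s, hs⟩ := V.exists_support
    rw [← V.sum_proj hs v]
    exact sum_mem fun i _ => Submodule.mem_iSup_of_mem i ⟨h i v hv, V.proj_mem i v⟩

/-- Independence: an element of `deg i` that also lies in the sum of the other components is both
fixed and killed by `p i`. -/
theorem isInternal_of_proj {M : Type*} [AddCommGroup M] [Module R M] {deg : ℤ → Submodule R M}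
    {p : ℤ → M →ₗ[R] M} (same : ∀ i, ∀ v ∈ deg i, p i v = v)
    (ne : ∀ i j, i ≠ j → ∀ v ∈ deg i, p j v = 0) (span : ⨆ i, deg i = ⊤) :
    DirectSum.IsInternal deg := by
  refine (DirectSum.isInternal_submodule_iff_iSupIndep_and_iSup_eq_top deg).2 ⟨fun i => ?_, span⟩
  rw [Submodule.disjoint_def]
  intro v hv hv'
  have : ⨆ j, ⨆ (_ : j ≠ i), deg j ≤ LinearMap.ker (p i) :=
    iSup₂_le fun j hj w hw => ne j i hj w hw
  rw [← same i v hv]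
  exact this hv'

/-- A graded submodule as a graded module. -/
def sub [IsNoetherianRing R] (V : GrMod 𝒮) (N : Submodule S V.carrier)
    (hN : V.IsGrSubmodule N) : GrMod 𝒮 where
  carrier := N
  finite := inferInstanceAs (Module.Finite R (N.restrictScalars R))
  deg i := (V.deg i).comap ((N.subtype).restrictScalars R)
  isInternal := by
    have hN' := isGrSubmodule_iff.1 hN
    refine isInternal_of_proj (p := fun i => (V.proj i).restrict
      (p := N.restrictScalars R) (q := N.restrictScalars R) (hN' i)) ?_ ?_ ?_
    · exact fun i v hv => Subtype.ext (V.proj_same hv)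
    · exact fun i j hij v hv => Subtype.ext (V.proj_ne hv hij)
    · refine eq_top_iff.2 fun v _ => ?_
      obtain ⟨s, hs⟩ := V.exists_support
      have : v = ∑ i ∈ s, (⟨V.proj i v, hN' i v v.2⟩ : N) := by
        apply Subtype.ext
        rw [AddSubmonoidClass.coe_finsetSum]
        exact (V.sum_proj hs v).symm
      rw [this]
      exact sum_mem fun i _ => Submodule.mem_iSup_of_mem i (V.proj_mem i v)
  smul_mem i j s v hs hv := V.smul_mem i j s v hs hv

/-- The quotient of a graded module by a graded submodule. -/
def quot (V : GrMod 𝒮) (N : Submodule S V.carrier) (hN : V.IsGrSubmodule N) : GrMod 𝒮 where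
  carrier := V.carrier ⧸ N
  finite := Module.Finite.of_surjective (N.mkQ.restrictScalars R) N.mkQ_surjective
  deg i := (V.deg i).map (N.mkQ.restrictScalars R)
  isInternal := by
    have hN' := isGrSubmodule_iff.1 hN
    refine isInternal_of_proj (p := fun i => (N.restrictScalars R).mapQ (N.restrictScalars R)
      (V.proj i) (hN' i)) ?_ ?_ ?_
    · rintro i _ ⟨v, hv, rfl⟩
      exact congrArg N.mkQ (V.proj_same hv)
    · rintro i j hij _ ⟨v, hv, rfl⟩
      exact congrArg N.mkQ (V.proj_ne hv hij)
    · rw [← Submodule.map_iSup,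
        ((DirectSum.isInternal_submodule_iff_iSupIndep_and_iSup_eq_top V.deg).1 V.isInternal).2,
        Submodule.map_top]
      exact LinearMap.range_eq_top.2 N.mkQ_surjective
  smul_mem := by
    rintro i j s _ hs ⟨v, hv, rfl⟩
    exact ⟨s • v, V.smul_mem i j s v hs hv, map_smul N.mkQ s v⟩

theorem isExtension_sub_quot [IsNoetherianRing R] (V : GrMod 𝒮) (N : Submodule S V.carrier)
    (hN : V.IsGrSubmodule N) : IsExtension (V.sub N hN) V (V.quot N hN) := by
  let f : (V.sub N hN).carrier →ₗ[S] V.carrier := N.subtype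
  let g : V.carrier →ₗ[S] (V.quot N hN).carrier := N.mkQ
  exact ⟨f, g, fun i v hv => hv, fun i v hv => ⟨v, hv, rfl⟩,
    N.subtype_injective, LinearMap.exact_subtype_mkQ N, N.mkQ_surjective⟩

/-- The direct sum of two graded modules. -/
def prod (V W : GrMod 𝒮) : GrMod 𝒮 where
  carrier := V.carrier × W.carrier
  deg i := (V.deg i).prod (W.deg i)
  isInternal := by
    refine isInternal_of_proj (p := fun i => (V.proj i).prodMap (W.proj i)) ?_ ?_ ?_
    · exact fun i v hv => Prod.ext (V.proj_same hv.1) (W.proj_same hv.2)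
    · exact fun i j hij v hv => Prod.ext (V.proj_ne hv.1 hij) (W.proj_ne hv.2 hij)
    · refine eq_top_iff.2 ?_
      rintro ⟨v, w⟩ -
      have hv : (v, (0 : W.carrier)) ∈ ⨆ i, (V.deg i).prod (W.deg i) := by
        induction v using V.homogeneous_induction with
        | hom i v hv => exact Submodule.mem_iSup_of_mem i ⟨hv, zero_mem _⟩
        | add v v' h h' => simpa using add_mem h h'
      have hw : ((0 : V.carrier), w) ∈ ⨆ i, (V.deg i).prod (W.deg i) := by
        induction w using W.homogeneous_induction with
        | hom i v hv => exact Submodule.mem_iSup_of_mem i ⟨zero_mem _, hv⟩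
        | add v v' h h' => simpa using add_mem h h'
      simpa using add_mem hv hw
  smul_mem i j s v hs hv := ⟨V.smul_mem i j s _ hs hv.1, W.smul_mem i j s _ hs hv.2⟩

theorem isExtension_prod (V W : GrMod 𝒮) : IsExtension V (V.prod W) W :=
  ⟨LinearMap.inl S V.carrier W.carrier, LinearMap.snd S V.carrier W.carrier,
    fun _ _ hv => ⟨hv, zero_mem _⟩, fun _ _ hv => hv.2, LinearMap.inl_injective,
    .inl_snd, LinearMap.snd_surjective⟩

variable (𝒮) in
/-- The zero module. -/
def zero : GrMod 𝒮 where
  carrier := PUnit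
  deg _ := ⊥
  isInternal := isInternal_of_proj (p := fun _ => 0) (fun _ _ _ => rfl) (fun _ _ _ _ _ => rfl)
    (Subsingleton.elim _ _)
  smul_mem _ _ _ _ _ _ := (Submodule.mem_bot R).2 rfl

theorem Iso.isExtension {V W : GrMod 𝒮} (h : Iso V W) : IsExtension (zero 𝒮) V W := by
  obtain ⟨f, hf, hb⟩ := h
  refine ⟨0, f, fun _ _ _ => by simp, hf, fun _ _ _ => rfl, ?_, hb.2⟩
  intro v
  simp [hb.1.eq_iff' (map_zero f), eq_comm]

theorem Iso.refl (V : GrMod 𝒮) : Iso V V :=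
  ⟨LinearMap.id, fun _ _ h => h, Function.bijective_id⟩

theorem isGrSimple_iff {V : GrMod 𝒮} : V.IsGrSimple ↔ Nontrivial V.carrier ∧
    ∀ N : Submodule S V.carrier, (∀ i, ∀ v ∈ N, V.proj i v ∈ N) → N = ⊥ ∨ N = ⊤ := by
  simp only [IsGrSimple, isGrSubmodule_iff]

/-- Schur's lemma for graded modules. -/
theorem IsGrHom.iso_of_isGrSimple {V W : GrMod 𝒮} {f : V.carrier →ₗ[S] W.carrier}
    (hf : IsGrHom f) (hV : V.IsGrSimple) (hW : W.IsGrSimple) (h0 : f ≠ 0) : Iso V W := by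
  rw [isGrSimple_iff] at hV hW
  refine ⟨f, hf, LinearMap.ker_eq_bot.1 ?_, LinearMap.range_eq_top.1 ?_⟩
  · refine (hV.2 (LinearMap.ker f) fun i v hv => ?_).resolve_right fun h =>
      h0 (LinearMap.ker_eq_top.1 h)
    rw [LinearMap.mem_ker] at hv ⊢
    rw [hf.map_proj, hv, map_zero]
  · refine (hW.2 (LinearMap.range f) ?_).resolve_left fun h => h0 (LinearMap.range_eq_bot.1 h)
    rintro i _ ⟨v, rfl⟩
    exact ⟨_, hf.map_proj i v⟩

theorem isGrSimple_of_isSimpleModule {V : GrMod 𝒮} (h : IsSimpleModule S V.carrier) :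
    V.IsGrSimple :=
  ⟨IsSimpleModule.nontrivial S V.carrier, fun N _ => eq_bot_or_eq_top N⟩

theorem mem_of_homogeneous (h𝒮 : ⨆ i, 𝒮 i = ⊤) {p : S → Prop} (hom : ∀ i, ∀ s ∈ 𝒮 i, p s)
    (add : ∀ s t, p s → p t → p (s + t)) (s : S) : p s :=
  Submodule.iSup_induction 𝒮 (motive := p) (h𝒮 ▸ Submodule.mem_top) hom (hom 0 0 (zero_mem _)) add

/-- The graded submodule of leading terms of the elements of a submodule. -/
def leadingTerms (h𝒮 : ⨆ i, 𝒮 i = ⊤) (V : GrMod 𝒮) (N : Submodule S V.carrier) :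
    Submodule S V.carrier where
  carrier := {v | ∀ i, ∃ n ∈ N, V.proj i n = V.proj i v ∧ ∀ j, i < j → V.proj j n = 0}
  zero_mem' i := ⟨0, zero_mem _, rfl, fun _ _ => map_zero _⟩
  add_mem' {v w} hv hw i := by
    obtain ⟨n, hn, h1, h2⟩ := hv i
    obtain ⟨n', hn', h1', h2'⟩ := hw i
    refine ⟨n + n', add_mem hn hn', by rw [map_add, map_add, h1, h1'], fun j hj => ?_⟩
    rw [map_add, h2 j hj, h2' j hj, add_zero]
  smul_mem' s v hv i := by
    induction s using mem_of_homogeneous h𝒮 with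
    | hom d s hs =>
      obtain ⟨n, hn, h1, h2⟩ := hv (i - d)
      have h : ∀ j w, V.proj j (s • w) = s • V.proj (j - d) w := fun j w => by
        rw [← V.proj_smul hs, add_sub_cancel]
      refine ⟨s • n, N.smul_mem s hn, by rw [h, h, h1], fun j hj => ?_⟩
      rw [h, h2 _ (by lia), smul_zero]
    | add s t hs ht =>
      obtain ⟨n, hn, h1, h2⟩ := hs
      obtain ⟨n', hn', h1', h2'⟩ := ht
      refine ⟨n + n', add_mem hn hn', by rw [add_smul, map_add, map_add, h1, h1'], fun j hj => ?_⟩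
      rw [map_add, h2 j hj, h2' j hj, add_zero]

/-- A simple graded module is simple as an ungraded module. -/
theorem IsGrSimple.isSimpleModule (h𝒮 : ⨆ i, 𝒮 i = ⊤) {V : GrMod 𝒮} (hV : V.IsGrSimple) :
    IsSimpleModule S V.carrier := by
  classical
  rw [isGrSimple_iff] at hV
  obtain ⟨hV1, hV2⟩ := hV
  refine isSimpleModule_iff S V.carrier |>.2 ⟨fun N => or_iff_not_imp_left.2 fun hN => ?_⟩
  -- The leading terms form a graded submodule, which is nonzero because it contains the top
  -- component of a nonzero element of `N`.
  have htop : leadingTerms h𝒮 V N = ⊤ := by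
    refine (hV2 (leadingTerms h𝒮 V N) fun i v hv j => ?_).resolve_left fun h => ?_
    · by_cases hij : i = j
      · subst hij
        rw [proj_proj_same]; exact hv i
      · exact ⟨0, zero_mem _, by rw [map_zero, V.proj_proj_ne hij], fun _ _ => map_zero _⟩
    · obtain ⟨n, hn, hn0⟩ := N.exists_mem_ne_zero_of_ne_bot hN
      obtain ⟨s, hs⟩ := V.exists_support_elt n
      have hne : (s.filter fun i => V.proj i n ≠ 0).Nonempty := by
        by_contra hemp
        apply hn0
        refine V.ext_proj fun i => ?_
        rw [map_zero]
        by_contra hi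
        exact hemp ⟨i, Finset.mem_filter.2 ⟨by_contra fun h' => hi (hs i h'), hi⟩⟩
      obtain ⟨i, hi, hmax⟩ := (s.filter fun i => V.proj i n ≠ 0).exists_max_image id hne
      have hmem : V.proj i n ∈ leadingTerms h𝒮 V N := by
        intro j
        by_cases hij : i = j
        · subst hij
          refine ⟨n, hn, (V.proj_proj_same _ _).symm, fun j hj => ?_⟩
          by_contra hj'
          exact absurd (hmax j (Finset.mem_filter.2 ⟨by_contra fun h' => hj' (hs j h'), hj'⟩))
            (not_le.2 hj)
        · exact ⟨0, zero_mem _, by rw [map_zero, V.proj_proj_ne hij], fun _ _ => map_zero _⟩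
      rw [h, Submodule.mem_bot] at hmem
      exact (Finset.mem_filter.1 hi).2 hmem
  obtain ⟨s, hs⟩ := V.exists_support
  obtain ⟨m, hm⟩ : ∃ m, ∀ i, i < m → V.proj i = 0 := by
    obtain ⟨m, hm⟩ := s.bddBelow
    exact ⟨m, fun i hi => hs i fun h => absurd (hm h) (not_le.2 hi)⟩
  -- Elements living in degrees below `m + k` are in `N`, by induction on `k`: subtracting an
  -- element of `N` with the same component in the highest allowed degree lowers the bound. Below
  -- `m` there is nothing but zero.
  have key : ∀ (k : ℕ) (v : V.carrier), (∀ j, m + k ≤ j → V.proj j v = 0) → v ∈ N := by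
    intro k
    induction k with
    | zero =>
      intro v hv
      have : v = 0 := V.ext_proj fun j => by
        rw [map_zero]
        rcases lt_or_ge j m with h | h
        · rw [hm j h, LinearMap.zero_apply]
        · exact hv j (by simpa using h)
      rw [this]; exact zero_mem _
    | succ k ih =>
      intro v hv
      have hvt : v ∈ leadingTerms h𝒮 V N := htop ▸ Submodule.mem_top
      obtain ⟨n, hn, h1, h2⟩ := hvt (m + k)
      have : v - n ∈ N := ih _ fun j hj => by
        rcases hj.eq_or_lt with h | h
        · rw [← h, map_sub, h1, sub_self]
        · rw [map_sub, h2 j h, hv j (by push_cast; lia), sub_zero]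
      simpa using add_mem this hn
  refine eq_top_iff.2 fun v _ => ?_
  obtain ⟨M, hM⟩ := s.bddAbove
  refine key (M - m + 1).toNat v fun j hj => ?_
  rw [hs j fun h => ?_, LinearMap.zero_apply]
  have := hM h
  lia

/-- Simple graded modules with isomorphic underlying modules agree up to a shift. -/
theorem IsGrSimple.exists_iso_shift (h𝒮 : ⨆ i, 𝒮 i = ⊤) {V W : GrMod 𝒮} (hV : V.IsGrSimple)
    (hW : W.IsGrSimple) (h : UngradedIso V W) : ∃ n, Iso V (W.shift n) := by
  classical
  obtain ⟨e⟩ := h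
  obtain ⟨s, hs⟩ := V.exists_support
  have hex : ∃ i, ∃ v ∈ V.deg i, e v ≠ 0 := by
    by_contra! hcon
    have := hV.1
    obtain ⟨v, hv0⟩ := exists_ne (0 : V.carrier)
    refine hv0 (e.map_eq_zero_iff.1 ?_)
    clear hv0
    induction v using V.homogeneous_induction with
    | hom i v hv => exact hcon i v hv
    | add v w hv hw =>
      rw [map_add, hv, hw, add_zero]
  obtain ⟨i, v, hv, hev⟩ := hex
  obtain ⟨j, hj⟩ : ∃ j, W.proj j (e v) ≠ 0 := by
    by_contra! hcon
    exact hev (W.ext_proj fun j => by rw [hcon, map_zero])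
  -- The homogeneous part of `e` of degree `j - i`, a degree chosen so that this part does not
  -- vanish at `v`.
  let f₀ : V.carrier →ₗ[R] W.carrier :=
    ∑ a ∈ s, W.proj (a + (j - i)) ∘ₗ (e.toLinearMap.restrictScalars R) ∘ₗ V.proj a
  have hf₀ : ∀ a, ∀ w ∈ V.deg a, f₀ w = W.proj (a + (j - i)) (e w) := fun a w hw => by
    simp only [f₀, LinearMap.sum_apply, LinearMap.comp_apply]
    rw [Finset.sum_eq_single a]
    · rw [V.proj_same hw]; rfl
    · intro b _ hb
      rw [V.proj_ne hw hb.symm, map_zero, map_zero]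
    · intro ha
      rw [hs a ha]; simp
  let f : V.carrier →ₗ[S] W.carrier :=
    { toFun := f₀
      map_add' := map_add f₀
      map_smul' := fun t w => by
        induction w using V.homogeneous_induction with
        | add w w' h h' => simp only [smul_add, map_add, h, h', RingHom.id_apply]
        | hom a w hw =>
          induction t using mem_of_homogeneous h𝒮 with
          | add t t' h h' => simp only [add_smul, map_add, h, h', RingHom.id_apply]
          | hom d t ht =>
            rw [hf₀ a w hw, hf₀ (d + a) _ (V.smul_mem d a t w ht hw), map_smul, add_assoc,
              W.proj_smul ht, RingHom.id_apply] }
  have hf : ∀ a, ∀ w ∈ V.deg a, f w = W.proj (a + (j - i)) (e w) := hf₀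
  refine ⟨i - j, IsGrHom.iso_of_isGrSimple (W := W.shift (i - j)) (f := f) ?_ hV ?_ ?_⟩
  · intro a w hw
    change f w ∈ W.deg (a - (i - j))
    rw [hf a w hw, show a - (i - j) = a + (j - i) by ring]
    exact W.proj_mem _ _
  · exact isGrSimple_of_isSimpleModule (V := W.shift (i - j)) (hW.isSimpleModule h𝒮)
  · intro h0
    apply hj
    have := hf i v hv
    rw [show i + (j - i) = j by ring] at this
    rw [← this, h0]; rfl

end Basic

end GrMod

/-! ### Graded composition series and degreewise characteristic polynomials. -/

namespace GrMod

section CompositionSeries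

variable {R S : Type u} [Field R] [Ring S] [Algebra R S] {𝒮 : ℤ → Submodule R S}

/-- Take `N` maximal among proper graded submodules and pull graded submodules of the quotient back
to `V`. -/
theorem exists_isGrSubmodule_quot_isGrSimple (V : GrMod 𝒮) (hV : Nontrivial V.carrier) :
    ∃ (N : Submodule S V.carrier) (hN : V.IsGrSubmodule N),
      N ≠ ⊤ ∧ (V.quot N hN).IsGrSimple := by
  have : IsNoetherian S V.carrier := isNoetherian_of_tower R inferInstance
  obtain ⟨N, ⟨hN, hNt⟩, hmax⟩ := set_has_maximal_iff_noetherian.2 this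
    {N : Submodule S V.carrier | V.IsGrSubmodule N ∧ N ≠ ⊤}
    ⟨⊥, isGrSubmodule_iff.2 fun i v hv => by
      rw [Submodule.mem_bot] at hv ⊢; rw [hv, map_zero], bot_ne_top⟩
  refine ⟨N, hN, hNt, isGrSimple_iff.2 ⟨Submodule.Quotient.nontrivial_iff.2 hNt, fun N' hN' => ?_⟩⟩
  let g : V.carrier →ₗ[S] (V.quot N hN).carrier := N.mkQ
  have hg : IsGrHom g := fun i v hv => ⟨v, hv, rfl⟩
  have hgs : Function.Surjective g := N.mkQ_surjective
  have hgk : ∀ v, g v = 0 ↔ v ∈ N := fun v => Submodule.Quotient.mk_eq_zero N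
  have hgr : V.IsGrSubmodule (N'.comap g) := isGrSubmodule_iff.2 fun i v hv => by
    rw [Submodule.mem_comap] at hv ⊢
    rw [hg.map_proj]
    exact hN' i _ hv
  have hle : N ≤ N'.comap g := fun v hv => by
    rw [Submodule.mem_comap, (hgk v).2 hv]; exact zero_mem _
  by_cases htop : N'.comap g = ⊤
  · right
    refine eq_top_iff.2 fun x _ => ?_
    obtain ⟨v, rfl⟩ := hgs x
    exact Submodule.mem_comap.1 (htop ▸ Submodule.mem_top)
  · left
    refine eq_bot_iff.2 fun x hx => ?_
    obtain ⟨v, rfl⟩ := hgs x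
    have heq : N = N'.comap g := by
      by_contra hne
      exact hmax _ ⟨hgr, htop⟩ (lt_of_le_of_ne hle hne)
    rw [Submodule.mem_bot, hgk, heq]
    exact hx

theorem exists_hasGrCompFactors (V : GrMod 𝒮) : ∃ l, HasGrCompFactors V l := by
  induction hn : Module.finrank R V.carrier using Nat.strong_induction_on generalizing V with
  | _ n ih =>
    rcases subsingleton_or_nontrivial V.carrier with h | h
    · exact ⟨[], .nil V h⟩
    · obtain ⟨N, hN, hNt, hs⟩ := V.exists_isGrSubmodule_quot_isGrSimple h
      have hlt : Module.finrank R (V.sub N hN).carrier < n := by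
        rw [← hn]
        exact Submodule.finrank_lt (s := N.restrictScalars R) fun h => hNt
          ((Submodule.restrictScalars_eq_top_iff R S V.carrier).1 h)
      obtain ⟨l, hl⟩ := ih _ hlt (V.sub N hN) rfl
      exact ⟨_, .cons _ V _ l hs (V.isExtension_sub_quot N hN) hl⟩

theorem HasGrCompFactors.isGrSimple {V : GrMod 𝒮} {l : List (GrMod 𝒮)}
    (h : HasGrCompFactors V l) : ∀ M ∈ l, M.IsGrSimple := by
  induction h with
  | nil => simp
  | cons V' V M l hM h hl ih => simpa [hM] using ih

/-- Either `f` is nonzero on `V'`, and induction applies, or it factors through the top factor `M`,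
which is also simple as an ungraded module, so that Schur's lemma applies. With `V` the regular
module this locates every simple module. -/
theorem HasGrCompFactors.exists_linearEquiv (h𝒮 : ⨆ i, 𝒮 i = ⊤) {V : GrMod 𝒮}
    {l : List (GrMod 𝒮)} (h : HasGrCompFactors V l) {T : Type*} [AddCommGroup T] [Module S T]
    [IsSimpleModule S T] (f : V.carrier →ₗ[S] T) (hf : f ≠ 0) :
    ∃ M ∈ l, Nonempty (M.carrier ≃ₗ[S] T) := by
  induction h with
  | nil V h => exact absurd (LinearMap.ext fun v => by
      rw [Subsingleton.elim v 0, map_zero, map_zero]) hf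
  | cons V' V M l hM h hl ih =>
    obtain ⟨i, g, -, -, -, hex, hg⟩ := h
    by_cases hfi : f ∘ₗ i = 0
    · have hle : LinearMap.ker g ≤ LinearMap.ker f := fun v hv => by
        obtain ⟨w, rfl⟩ := (hex v).1 hv
        exact LinearMap.congr_fun hfi w
      let f' : M.carrier →ₗ[S] T :=
        (LinearMap.ker g).liftQ f hle ∘ₗ (g.quotKerEquivOfSurjective hg).symm.toLinearMap
      have hf' : ∀ v, f' (g v) = f v := fun v => by
        have : (g.quotKerEquivOfSurjective hg).symm (g v) = Submodule.Quotient.mk v := by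
          rw [LinearEquiv.symm_apply_eq]; rfl
        change (LinearMap.ker g).liftQ f hle ((g.quotKerEquivOfSurjective hg).symm (g v)) = _
        rw [this]; rfl
      have : IsSimpleModule S M.carrier := hM.isSimpleModule h𝒮
      refine ⟨M, by simp, ⟨LinearEquiv.ofBijective f' (LinearMap.bijective_of_ne_zero ?_)⟩⟩
      rintro h0
      exact hf (LinearMap.ext fun v => by rw [← hf', h0]; rfl)
    · obtain ⟨N, hN, he⟩ := ih (f ∘ₗ i) hfi
      exact ⟨N, List.mem_cons_of_mem _ hN, he⟩

end CompositionSeries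

section CharPoly

variable {R S : Type u} [CommRing R] [Ring S] [Algebra R S] {𝒮 : ℤ → Submodule R S}

/-- The action of `s` on the component of degree `i`, extended by zero. -/
noncomputable def op (V : GrMod 𝒮) (s : S) (i : ℤ) : V.carrier →ₗ[R] V.carrier :=
  Algebra.lsmul R R V.carrier s ∘ₗ V.proj i

theorem op_apply (V : GrMod 𝒮) (s : S) (i : ℤ) (v : V.carrier) :
    V.op s i v = s • V.proj i v := rfl

/-- The characteristic polynomial of `GrMod.op`. -/
noncomputable def cp (V : GrMod 𝒮) [Module.Free R V.carrier] (s : S) (i : ℤ) : Polynomial R :=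
  (V.op s i).charpoly

theorem cp_monic (V : GrMod 𝒮) [Module.Free R V.carrier] (s : S) (i : ℤ) : (V.cp s i).Monic :=
  LinearMap.charpoly_monic _

theorem shift_proj (V : GrMod 𝒮) (n i : ℤ) : (V.shift n).proj i = V.proj (i - n) :=
  (V.shift n).linearMap_ext_homogeneous fun j v hv => by
    by_cases hij : j = i
    · subst hij
      rw [proj_same _ hv]
      exact (V.proj_same hv).symm
    · rw [proj_ne _ hv hij]
      exact (V.proj_ne (i := j - n) hv (by lia)).symm

theorem cp_shift (V : GrMod 𝒮) (n : ℤ) [Module.Free R V.carrier]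
    [Module.Free R (V.shift n).carrier] (s : S) (i : ℤ) :
    (V.shift n).cp s i = V.cp s (i - n) := by
  have h := V.shift_proj n i
  unfold cp op
  rw [h]
  rfl

end CharPoly

section CharPolyField

variable {R S : Type u} [Field R] [Ring S] [Algebra R S] {𝒮 : ℤ → Submodule R S}

/-- Graded homomorphisms commute with the projections and with `s`, hence intertwine the operators
`op`. -/
theorem IsExtension.cp_eq_mul {V' V V'' : GrMod 𝒮} (h : IsExtension V' V V'') (s : S) (i : ℤ) :
    V.cp s i = V'.cp s i * V''.cp s i := by
  obtain ⟨f, g, hf, hg, h1, h2, h3⟩ := h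
  refine LinearMap.charpoly_eq_mul_of_exact (f := f.restrictScalars R)
    (g := g.restrictScalars R) h1 h2 h3 (fun x => ?_) (fun x => ?_)
  · change s • V.proj i (f x) = f (s • V'.proj i x)
    rw [map_smul, hf.map_proj]
  · change g (s • V.proj i x) = s • V''.proj i (g x)
    rw [map_smul, hg.map_proj]

theorem cp_of_subsingleton (V : GrMod 𝒮) [Subsingleton V.carrier] (s : S) (i : ℤ) :
    V.cp s i = 1 := by
  refine Polynomial.eq_one_of_monic_natDegree_zero (V.cp_monic s i) ?_
  rw [cp, LinearMap.charpoly_natDegree, Module.finrank_zero_of_subsingleton]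

theorem Iso.cp_eq {V W : GrMod 𝒮} (h : Iso V W) (s : S) (i : ℤ) : V.cp s i = W.cp s i := by
  have : Subsingleton (zero 𝒮).carrier := inferInstanceAs (Subsingleton PUnit)
  rw [h.isExtension.cp_eq_mul s i, cp_of_subsingleton, one_mul]

end CharPolyField

section BaseChange

variable {A H : Type u} [CommRing A] [Ring H] [Algebra A H] {ℋ : ℤ → Submodule A H}
  {R : Type u} [CommRing R] [Algebra A R] (V : GrModOver ℋ R)
  (R' : Type u) [CommRing R'] [Algebra A R'] [Algebra R R'] [IsScalarTower A R R']

theorem baseChange_proj (i : ℤ) :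
    (V.baseChange R').proj i = (V.proj i).baseChange R' := by
  refine (V.baseChange R').linearMap_ext_homogeneous fun j v hv => ?_
  have hv' : v ∈ (V.deg j).baseChange R' := hv
  by_cases hij : j = i
  · subst hij
    rw [proj_same _ hv]
    rw [Submodule.baseChange_eq_span] at hv'
    clear hv
    induction hv' using Submodule.span_induction with
    | zero => exact (map_zero _).symm
    | add x y _ _ hx hy => exact (congrArg₂ (· + ·) hx hy).trans (map_add _ _ _).symm
    | smul a x _ hx => exact (congrArg (a • ·) hx).trans (map_smul _ _ _).symm
    | mem x hx =>
      obtain ⟨w, hw, rfl⟩ := hx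
      change (1 : R') ⊗ₜ[R] w = (1 : R') ⊗ₜ[R] V.proj j w
      rw [V.proj_same hw]
  · rw [proj_ne _ hv hij]
    rw [Submodule.baseChange_eq_span] at hv'
    clear hv
    induction hv' using Submodule.span_induction with
    | zero => exact (map_zero _).symm
    | add x y _ _ hx hy =>
      refine Eq.trans ?_ (map_add _ _ _).symm
      rw [← hx, ← hy, add_zero]
    | smul a x _ hx =>
      refine Eq.trans ?_ (map_smul _ _ _).symm
      rw [← hx, smul_zero]
    | mem x hx =>
      obtain ⟨w, hw, rfl⟩ := hx
      change _ = (1 : R') ⊗ₜ[R] V.proj i w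
      rw [V.proj_ne hw hij, TensorProduct.tmul_zero]
      rfl

theorem baseChange_smul_tmul (a b : R') (h : H) (v : V.carrier) :
    (show (V.baseChange R').carrier from
      ((a ⊗ₜ[A] h : R' ⊗[A] H) • (show (V.baseChange R').carrier from b ⊗ₜ[R] v))) =
      (a * b) ⊗ₜ[R] (((1 : R) ⊗ₜ[A] h) • v) :=
  baseChangeRep_tmul R H R' V.carrier a b h v

theorem baseChange_op (h : H) (i : ℤ) :
    (V.baseChange R').op ((1 : R') ⊗ₜ[A] h) i = (V.op ((1 : R) ⊗ₜ[A] h) i).baseChange R' := by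
  unfold op
  rw [baseChange_proj]
  refine TensorProduct.AlgebraTensorModule.ext (R := R) (A := R') (M := R') (N := V.carrier)
    (P := R' ⊗[R] V.carrier) fun a v => ?_
  change (((1 : R') ⊗ₜ[A] h : R' ⊗[A] H) • (show (V.baseChange R').carrier from
    a ⊗ₜ[R] V.proj i v)) = a ⊗ₜ[R] (((1 : R) ⊗ₜ[A] h : R ⊗[A] H) • V.proj i v)
  exact (V.baseChange_smul_tmul R' 1 a h _).trans (by rw [one_mul])

theorem cp_baseChange [Module.Free R V.carrier] [Module.Free R' (V.baseChange R').carrier]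
    (h : H) (i : ℤ) :
    (V.baseChange R').cp ((1 : R') ⊗ₜ[A] h) i =
      (V.cp ((1 : R) ⊗ₜ[A] h) i).map (algebraMap R R') := by
  unfold cp
  rw [baseChange_op]
  exact LinearMap.charpoly_baseChange (V.op ((1 : R) ⊗ₜ[A] h) i) R'

variable (ℋ R) in
theorem iSup_baseChange [GradedAlgebra ℋ] : ⨆ i, (ℋ i).baseChange R = ⊤ := by
  refine eq_top_iff.2 fun x _ => ?_
  induction x using TensorProduct.induction_on with
  | zero => exact zero_mem _
  | add x y hx hy => exact add_mem (hx trivial) (hy trivial)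
  | tmul a h =>
    induction h using DirectSum.Decomposition.inductionOn ℋ with
    | zero => rw [TensorProduct.tmul_zero]; exact zero_mem _
    | add x y hx hy => rw [TensorProduct.tmul_add]; exact add_mem (hx trivial) (hy trivial)
    | homogeneous m =>
      exact Submodule.mem_iSup_of_mem _ (Submodule.tmul_mem_baseChange_of_mem a m.2)

end BaseChange

end GrMod

/-! ### Rank-one operators, Burnside's theorem and the regular module. -/

section LinearAlgebra

open Polynomial

variable {F V : Type*} [Field F] [AddCommGroup V] [Module F V] [Module.Finite F V]

theorem LinearMap.rootMultiplicity_charpoly_zero {c : F} (hc : c ≠ 0) :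
    (0 : V →ₗ[F] V).charpoly.rootMultiplicity c = 0 := by
  refine rootMultiplicity_eq_zero ?_
  rw [LinearMap.charpoly_zero]
  simp [hc]

/-- The rank-one operator `x ↦ ξ x • v` vanishes on `ker ξ` and induces multiplication by `ξ v` on
the quotient `F`, so the nonzero eigenvalue `ξ v` is simple. -/
theorem LinearMap.rootMultiplicity_charpoly_smulRight (ξ : V →ₗ[F] F) (v : V) (hv : ξ v ≠ 0) :
    (ξ.smulRight v).charpoly.rootMultiplicity (ξ v) = 1 := by
  have hs : Function.Surjective ξ := LinearMap.surjective fun h => hv (by rw [h]; rfl)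
  let b : F →ₗ[F] F := LinearMap.lsmul F F (ξ v)
  have hb : b.charpoly = X - C (ξ v) := by
    -- The polynomial is monic of degree one; Cayley–Hamilton evaluated at `1` gives its constant
    -- term.
    have h1 : b.charpoly = X + C (b.charpoly.coeff 0) :=
      b.charpoly_monic.eq_X_add_C (by rw [LinearMap.charpoly_natDegree, Module.finrank_self])
    have h2 := LinearMap.congr_fun b.aeval_self_charpoly 1
    rw [h1] at h2 ⊢
    have h3 : ξ v + b.charpoly.coeff 0 = 0 := by
      simpa [b, Module.algebraMap_end_apply] using h2
    rw [eq_neg_of_add_eq_zero_right h3, map_neg, sub_eq_add_neg]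
  have h := LinearMap.charpoly_eq_mul_of_exact (f := (LinearMap.ker ξ).subtype) (g := ξ)
    (a' := 0) (a := ξ.smulRight v) (a'' := b) (Submodule.subtype_injective _)
    (LinearMap.exact_subtype_ker_map ξ) hs (fun x => by simp)
    (fun x => by simp [b, mul_comm])
  rw [h, rootMultiplicity_mul (mul_ne_zero (LinearMap.charpoly_monic _).ne_zero
    (LinearMap.charpoly_monic _).ne_zero), LinearMap.rootMultiplicity_charpoly_zero hv, hb,
    rootMultiplicity_X_sub_C_self]

end LinearAlgebra

/-- Burnside's theorem: an algebra acts on finitely many pairwise non-isomorphic simple modules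
with scalar endomorphisms through all tuples of linear endomorphisms. -/
theorem exists_smul_eq_of_isSimpleModule {F S ι : Type*} [Field F] [Ring S] [Algebra F S]
    [Finite ι] {M : ι → Type*} [∀ i, AddCommGroup (M i)] [∀ i, Module F (M i)]
    [∀ i, Module S (M i)] [∀ i, IsScalarTower F S (M i)] [∀ i, Module.Finite F (M i)]
    (simple : ∀ i, IsSimpleModule S (M i))
    (noniso : ∀ i j, Nonempty (M i ≃ₗ[S] M j) → i = j)
    (scalar : ∀ i (f : M i →ₗ[S] M i), ∃ c : F, ∀ m, f m = c • m)
    (f : ∀ i, M i →ₗ[F] M i) : ∃ s : S, ∀ i m, s • m = f i m := by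
  classical
  have := Fintype.ofFinite ι
  -- By Schur's lemma the off-diagonal entries of an endomorphism of the product vanish; its
  -- diagonal entries are scalars. Hence every tuple `f` commutes with all such endomorphisms, and
  -- the density theorem applies to it.
  have key : ∀ (g : (∀ i, M i) →ₗ[S] (∀ i, M i)) (i : ι), ∃ c : F, ∀ x, g x i = c • x i := by
    intro g i
    obtain ⟨c, hc⟩ := scalar i (LinearMap.proj i ∘ₗ g ∘ₗ LinearMap.single S M i)
    refine ⟨c, fun x => ?_⟩
    have hx : x = ∑ j, LinearMap.single S M j (x j) := by
      simp [LinearMap.coe_single, Finset.univ_sum_single]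
    conv_lhs => rw [hx]
    rw [map_sum, Finset.sum_apply, Finset.sum_eq_single i]
    · exact hc (x i)
    · intro j _ hj
      rcases LinearMap.bijective_or_eq_zero (LinearMap.proj i ∘ₗ g ∘ₗ LinearMap.single S M j)
        with h | h
      · exact absurd (noniso j i ⟨LinearEquiv.ofBijective _ h⟩) hj
      · exact LinearMap.congr_fun h (x j)
    · simp
  let φ : Module.End (Module.End S (∀ i, M i)) (∀ i, M i) :=
    { toFun := fun x i => f i (x i)
      map_add' := fun x y => funext fun i => map_add (f i) _ _
      map_smul' := fun g x => funext fun i => by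
        obtain ⟨c, hc⟩ := key g i
        change f i (g x i) = g (fun i => f i (x i)) i
        rw [hc, hc, map_smul] }
  obtain ⟨t, ht⟩ := Module.Finite.fg_top (R := F) (M := ∀ i, M i)
  obtain ⟨s, hs⟩ := jacobson_density φ t
  have h : (LinearMap.pi fun i => f i ∘ₗ LinearMap.proj i) = Algebra.lsmul F F (∀ i, M i) s :=
    LinearMap.ext_on ht fun x hx => hs x hx
  refine ⟨s, fun i m => ?_⟩
  have := congrFun (LinearMap.congr_fun h (Pi.single i m)) i
  simpa using this.symm

theorem IsSplitAlgebra.exists_smul_eq {F S : Type u} [Field F] [Ring S] [Algebra F S]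
    (h : IsSplitAlgebra F S) {M : Type u} [AddCommGroup M] [Module F M] [Module S M]
    [IsScalarTower F S M] [Module.Finite F M] (hM : IsSimpleModule S M) (f : M →ₗ[F] M) :
    ∃ s : S, ∀ m, s • m = f m := by
  obtain ⟨s, hs⟩ := exists_smul_eq_of_isSimpleModule (ι := Unit) (M := fun _ => M)
    (fun _ => hM) (fun _ _ _ => rfl) (fun _ f => h M hM f) (fun _ => f)
  exact ⟨s, hs ()⟩

namespace GrMod

section

variable {R S : Type u} [CommRing R] [Ring S] [Algebra R S] {𝒮 : ℤ → Submodule R S}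

theorem exists_homogeneous_ne_zero (V : GrMod 𝒮) (hV : Nontrivial V.carrier) :
    ∃ i, ∃ v ∈ V.deg i, v ≠ 0 := by
  obtain ⟨v, hv⟩ := exists_ne (0 : V.carrier)
  by_contra! h
  refine hv (V.ext_proj fun i => ?_)
  rw [h i _ (V.proj_mem i v), map_zero]

/-- Here `s₀` collects the degree-zero terms of `s`, the only ones that preserve degrees. One `s₀`
serves all graded modules at once. -/
theorem exists_degree_zero (h𝒮 : ⨆ i, 𝒮 i = ⊤) (s : S) :
    ∃ s₀ ∈ 𝒮 0, ∀ (V : GrMod 𝒮) (i : ℤ), ∀ v ∈ V.deg i, V.proj i (s • v) = s₀ • v := by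
  induction s using mem_of_homogeneous h𝒮 with
  | hom d s hs =>
    by_cases hd : d = 0
    · subst hd
      exact ⟨s, hs, fun V i v hv => V.proj_same (by simpa using V.smul_mem 0 i s v hs hv)⟩
    · exact ⟨0, zero_mem _, fun V i v hv => by
        rw [V.proj_ne (V.smul_mem d i s v hs hv) (by lia), zero_smul]⟩
  | add s t hs ht =>
    obtain ⟨s₀, hs₀, h⟩ := hs
    obtain ⟨t₀, ht₀, h'⟩ := ht
    exact ⟨s₀ + t₀, add_mem hs₀ ht₀, fun V i v hv => by
      rw [add_smul, add_smul, map_add, h V i v hv, h' V i v hv]⟩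

end

section

variable {A H : Type u} [CommRing A] [Ring H] [Algebra A H] (ℋ : ℤ → Submodule A H)
  (R : Type u) [CommRing R] [Algebra A R] [GradedAlgebra ℋ]

/-- The regular graded module. -/
noncomputable def reg [Module.Finite A H] : GrModOver ℋ R where
  carrier := R ⊗[A] H
  deg i := (ℋ i).baseChange R
  isInternal := by
    refine isInternal_of_proj (p := fun i => (GradedAlgebra.proj ℋ i).baseChange R) ?_ ?_
      (iSup_baseChange ℋ R)
    · intro i v hv
      rw [Submodule.baseChange_eq_span] at hv
      induction hv using Submodule.span_induction with
      | zero => rw [map_zero]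
      | add x y _ _ hx hy => rw [map_add, hx, hy]
      | smul a x _ hx => rw [map_smul, hx]
      | mem x hx =>
        obtain ⟨h, hh, rfl⟩ := hx
        rw [TensorProduct.mk_apply, LinearMap.baseChange_tmul, GradedAlgebra.proj_apply,
          DirectSum.decompose_of_mem_same ℋ hh]
    · intro i j hij v hv
      rw [Submodule.baseChange_eq_span] at hv
      induction hv using Submodule.span_induction with
      | zero => rw [map_zero]
      | add x y _ _ hx hy => rw [map_add, hx, hy, add_zero]
      | smul a x _ hx => rw [map_smul, hx, smul_zero]
      | mem x hx =>
        obtain ⟨h, hh, rfl⟩ := hx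
        rw [TensorProduct.mk_apply, LinearMap.baseChange_tmul, GradedAlgebra.proj_apply,
          DirectSum.decompose_of_mem_ne ℋ hh hij, TensorProduct.tmul_zero]
  smul_mem i j s v hs hv := by
    rw [Submodule.baseChange_eq_span] at hs hv
    induction hs using Submodule.span_induction with
    | zero => rw [zero_smul]; exact zero_mem _
    | add x y _ _ hx hy => rw [add_smul]; exact add_mem hx hy
    | smul a x _ hx => rw [smul_assoc]; exact Submodule.smul_mem _ _ hx
    | mem x hx =>
      obtain ⟨h, hh, rfl⟩ := hx
      induction hv using Submodule.span_induction with
      | zero => rw [smul_zero]; exact zero_mem _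
      | add x y _ _ hx hy => rw [smul_add]; exact add_mem hx hy
      | smul a x _ hx => rw [smul_comm]; exact Submodule.smul_mem _ _ hx
      | mem y hy =>
        obtain ⟨w, hw, rfl⟩ := hy
        simp only [TensorProduct.mk_apply, smul_eq_mul, Algebra.TensorProduct.tmul_mul_tmul]
        exact Submodule.tmul_mem_baseChange_of_mem _ (SetLike.mul_mem_graded hh hw)

end

end GrMod

/-! ### Representatives of the simple graded modules. -/

section IrrSystem

variable {A H : Type u} [CommRing A] [Ring H] [Algebra A H] {ℋ : ℤ → Submodule A H}
  {F : Type u} [Field F] [Algebra A F] [GradedAlgebra ℋ]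

/-- A nonzero `x` in `N` gives the nonzero map `s ↦ s • x` from the regular module, so `N` occurs
among the composition factors of the latter. -/
theorem exists_factor_linearEquiv [Module.Finite A H] {l : List (GrModOver ℋ F)}
    (hl : GrMod.HasGrCompFactors (GrMod.reg ℋ F) l) {N : Type*} [AddCommGroup N]
    [Module (F ⊗[A] H) N] (hN : IsSimpleModule (F ⊗[A] H) N) :
    ∃ M ∈ l, Nonempty (M.carrier ≃ₗ[F ⊗[A] H] N) := by
  have := IsSimpleModule.nontrivial (F ⊗[A] H) N
  obtain ⟨x, hx⟩ := exists_ne (0 : N)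
  refine hl.exists_linearEquiv (GrMod.iSup_baseChange ℋ F)
    (LinearMap.toSpanSingleton (F ⊗[A] H) N x) fun h => hx ?_
  have h1 := LinearMap.congr_fun h 1
  rw [LinearMap.toSpanSingleton_apply, one_smul] at h1
  exact h1

variable (ℋ F) in
theorem exists_isGrIrrSystem [Module.Finite A H] :
    ∃ (ι : Type) (_ : Finite ι) (M : ι → GrModOver ℋ F), IsGrIrrSystem M := by
  obtain ⟨l, hl⟩ := (GrMod.reg ℋ F).exists_hasGrCompFactors
  let st : Setoid (Fin l.length) :=
    { r := fun a b => GrMod.UngradedIso (l.get a) (l.get b)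
      iseqv := ⟨fun a => ⟨LinearEquiv.refl _ _⟩, fun ⟨e⟩ => ⟨e.symm⟩,
        fun ⟨e⟩ ⟨e'⟩ => ⟨e.trans e'⟩⟩ }
  refine ⟨Quotient st, inferInstance, fun q => l.get q.out, fun q => ?_, fun q q' h => ?_, ?_⟩
  · exact (hl.isGrSimple _ (List.get_mem l _)).isSimpleModule (GrMod.iSup_baseChange ℋ F)
  · rw [← Quotient.out_eq q, ← Quotient.out_eq q']
    exact Quotient.sound h
  · intro N _ _ hN
    obtain ⟨M, hM, ⟨e⟩⟩ := exists_factor_linearEquiv hl hN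
    obtain ⟨a, rfl⟩ := List.get_of_mem hM
    obtain ⟨e'⟩ : GrMod.UngradedIso (l.get (Quotient.mk st a).out) (l.get a) :=
      Quotient.mk_out (s := st) a
    exact ⟨Quotient.mk st a, ⟨e.symm.trans e'.symm⟩⟩

theorem IsGrIrrSystem.finite [Module.Finite A H] {ι : Type*} {M : ι → GrModOver ℋ F}
    (h : IsGrIrrSystem M) : Finite ι := by
  obtain ⟨κ, _, M', h'⟩ := exists_isGrIrrSystem ℋ F
  choose g hg using fun i => h'.exhaust (M i).carrier (h.simple i)
  refine Finite.of_injective g fun i j hij => h.unique i j ?_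
  obtain ⟨e⟩ := hg i
  obtain ⟨e'⟩ := hg j
  rw [hij] at e
  exact ⟨e.trans e'.symm⟩

theorem IsGrIrrSystem.exists_iso_shift {ι : Type*} {M : ι → GrModOver ℋ F}
    (h : IsGrIrrSystem M) {T : GrModOver ℋ F} (hT : T.IsGrSimple) :
    ∃ j n, GrMod.Iso T ((M j).shift n) := by
  have h𝒮 := GrMod.iSup_baseChange ℋ F
  obtain ⟨j, hj⟩ := h.exhaust T.carrier (hT.isSimpleModule h𝒮)
  exact ⟨j, hT.exists_iso_shift h𝒮 (GrMod.isGrSimple_of_isSimpleModule (h.simple j)) hj⟩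

/-- Clears denominators. The elements used for testing must come from `H` itself, since they have to
act over all the base rings at the same time. -/
theorem exists_smul_eq_tmul_one (hF : ∀ x : F, ∃ a b : A, algebraMap A F b ≠ 0 ∧
      algebraMap A F b * x = algebraMap A F a) {N : Submodule A H} {s : F ⊗[A] H}
    (hs : s ∈ N.baseChange F) :
    ∃ a : A, algebraMap A F a ≠ 0 ∧ ∃ h ∈ N, algebraMap A F a • s = (1 : F) ⊗ₜ[A] h := by
  have key : ∀ (a : A) (h : H), algebraMap A F a • ((1 : F) ⊗ₜ[A] h) = (1 : F) ⊗ₜ[A] (a • h) :=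
    fun a h => by rw [TensorProduct.smul_tmul', TensorProduct.tmul_smul, TensorProduct.smul_tmul',
      smul_eq_mul, mul_one, Algebra.smul_def, mul_one]
  rw [Submodule.baseChange_eq_span] at hs
  induction hs using Submodule.span_induction with
  | zero => exact ⟨1, by simp, 0, zero_mem _, by simp⟩
  | add x y _ _ hx hy =>
    obtain ⟨a, ha, h, hh, e⟩ := hx
    obtain ⟨a', ha', h', hh', e'⟩ := hy
    refine ⟨a' * a, by simp [ha, ha'], a' • h + a • h',
      add_mem (N.smul_mem _ hh) (N.smul_mem _ hh'), ?_⟩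
    rw [TensorProduct.tmul_add, ← key, ← key, ← e, ← e', smul_smul, smul_smul, ← map_mul,
      ← map_mul, smul_add, mul_comm a a']
  | smul c x _ hx =>
    obtain ⟨a, ha, h, hh, e⟩ := hx
    obtain ⟨p, q, hq, hpq⟩ := hF c
    refine ⟨q * a, by simp [ha, hq], p • h, N.smul_mem _ hh, ?_⟩
    rw [← key, ← e, smul_smul, smul_smul, map_mul, mul_right_comm, hpq]
  | mem x hx =>
    obtain ⟨h, hh, rfl⟩ := hx
    exact ⟨1, by simp, h, hh, by simp⟩

end IrrSystem

/-- Representatives `M j` of the simple graded modules up to isomorphism and shift, together with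
elements `elt j` of degree zero and scalars `eig j` that detect composition factors: the number of
factors `(M j)⟨n⟩` is the algebraic multiplicity of the eigenvalue `eig j` of `elt j` in degree
`n + pos j`. -/
structure TestSystem {A H : Type u} [CommRing A] [Ring H] [Algebra A H] (ℋ : ℤ → Submodule A H)
    (F : Type u) [Field F] [Algebra A F] (ι : Type*) where
  M : ι → GrModOver ℋ F
  simple : ∀ j, IsSimpleModule (F ⊗[A] H) (M j).carrier
  exhaust : ∀ T : GrModOver ℋ F, T.IsGrSimple → ∃ j n, GrMod.Iso T ((M j).shift n)
  elt : ι → H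
  elt_mem : ∀ j, elt j ∈ ℋ 0
  eig : ι → F
  pos : ι → ℤ
  rootMultiplicity_pos : ∀ j, ((M j).cp ((1 : F) ⊗ₜ[A] elt j) (pos j)).rootMultiplicity (eig j) = 1
  rootMultiplicity_of_ne : ∀ j j' i, (j ≠ j' ∨ i ≠ pos j) →
    ((M j').cp ((1 : F) ⊗ₜ[A] elt j) i).rootMultiplicity (eig j) = 0

/-! ### Composition multiplicities read off from eigenvalues. -/

namespace TestSystem

open GrMod

variable {A H : Type u} [CommRing A] [Ring H] [Algebra A H] {ℋ : ℤ → Submodule A H}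
  {F : Type u} [Field F] [Algebra A F] {ι : Type*} (t : TestSystem ℋ F ι)

/-- The multiplicity of `(M j)⟨n⟩` as a graded composition factor of `V`. -/
noncomputable def mult (V : GrModOver ℋ F) (j : ι) (n : ℤ) : ℕ :=
  (V.cp ((1 : F) ⊗ₜ[A] t.elt j) (n + t.pos j)).rootMultiplicity (t.eig j)

theorem mult_isExtension {V' V V'' : GrModOver ℋ F} (h : IsExtension V' V V'') (j : ι) (n : ℤ) :
    t.mult V j n = t.mult V' j n + t.mult V'' j n := by
  rw [mult, h.cp_eq_mul, Polynomial.rootMultiplicity_mul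
    (mul_ne_zero (cp_monic _ _ _).ne_zero (cp_monic _ _ _).ne_zero)]
  rfl

theorem mult_iso {V W : GrModOver ℋ F} (h : Iso V W) (j : ι) (n : ℤ) :
    t.mult V j n = t.mult W j n := by rw [mult, h.cp_eq, mult]

theorem mult_of_subsingleton (V : GrModOver ℋ F) [Subsingleton V.carrier] (j : ι) (n : ℤ) :
    t.mult V j n = 0 := by
  rw [mult, cp_of_subsingleton]
  exact Polynomial.rootMultiplicity_eq_zero (by simp [Polynomial.IsRoot])

theorem mult_shift (V : GrModOver ℋ F) (m : ℤ) (j : ι) (n : ℤ) :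
    t.mult (V.shift m) j n = t.mult V j (n - m) := by
  rw [mult, cp_shift, mult]
  congr 2; ring

open Classical in
-- Orthogonality of tests and simple modules; together with additivity it makes `mult` count
-- composition factors.
theorem mult_M_shift (j j' : ι) (n n' : ℤ) :
    t.mult ((t.M j').shift n') j n = if (j', n') = (j, n) then 1 else 0 := by
  rw [mult_shift, mult]
  split_ifs with h
  · obtain ⟨rfl, rfl⟩ := Prod.mk.inj h
    rw [sub_self, zero_add]; exact t.rootMultiplicity_pos j'
  · refine t.rootMultiplicity_of_ne j j' _ ?_
    by_contra! hcon
    exact h (Prod.ext hcon.1.symm (by simp only; linarith [hcon.2]))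

theorem isGrSimple_shift (j : ι) (n : ℤ) : ((t.M j).shift n).IsGrSimple :=
  isGrSimple_of_isSimpleModule (V := (t.M j).shift n) (t.simple j)

open Classical in
-- The labels `(j, n)` of the factors of one composition series. Since their counts equal `mult`,
-- which does not refer to the series, this plays the role of the Jordan–Hölder theorem.
theorem exists_labels (V : GrModOver ℋ F) : ∃ a : Multiset (ι × ℤ),
    (∀ j n, a.count (j, n) = t.mult V j n) ∧
    GrK0.cls V = (a.map fun p => GrK0.cls ((t.M p.1).shift p.2)).sum ∧
    ∀ s i, V.cp s i = (a.map fun p => ((t.M p.1).shift p.2).cp s i).prod := by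
  obtain ⟨l, hl⟩ := V.exists_hasGrCompFactors
  induction hl with
  | nil V h =>
    refine ⟨0, fun j n => by rw [Multiset.count_zero, mult_of_subsingleton], ?_,
      fun s i => by simp [cp_of_subsingleton]⟩
    -- A zero module is an extension of itself by itself, so its class satisfies `[V] = [V] + [V]`
    -- and vanishes.
    have : IsExtension V V V := ⟨0, 0, by intro; simp, by intro; simp, fun _ _ _ => h.elim _ _,
      fun x => ⟨fun _ => ⟨0, h.elim _ _⟩, fun _ => h.elim _ _⟩, fun x => ⟨0, h.elim _ _⟩⟩
    simpa using GrK0.cls_eq_add this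
  | cons V' V M l hM h hl ih =>
    obtain ⟨a, h1, h2, h3⟩ := ih
    obtain ⟨j', n', e⟩ := t.exhaust M hM
    refine ⟨(j', n') ::ₘ a, fun j n => ?_, ?_, fun s i => ?_⟩
    · rw [t.mult_isExtension h, Multiset.count_cons, h1, t.mult_iso e, t.mult_M_shift]
      simp only [eq_comm]
    · have hz : GrK0.cls (zero fun i => (ℋ i).baseChange F) = 0 := by
        have := GrK0.cls_eq_add (Iso.refl (zero fun i => (ℋ i).baseChange F)).isExtension
        simpa using this
      rw [GrK0.cls_eq_add h, h2, GrK0.cls_eq_add e.isExtension, hz, zero_add, Multiset.map_cons,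
        Multiset.sum_cons, add_comm]
    · rw [h.cp_eq_mul, h3, e.cp_eq, Multiset.map_cons, Multiset.prod_cons, mul_comm]

theorem cls_eq_of_mult {V W : GrModOver ℋ F} (h : ∀ j n, t.mult V j n = t.mult W j n) :
    GrK0.cls V = GrK0.cls W := by
  classical
  obtain ⟨a, h1, h2, -⟩ := t.exists_labels V
  obtain ⟨b, h1', h2', -⟩ := t.exists_labels W
  have : a = b := Multiset.ext' fun ⟨j, n⟩ => by rw [h1, h1', h]
  rw [h2, h2', this]

/-- Being additive on short exact sequences, `mult` factors through the Grothendieck group. -/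
theorem mult_eq_of_cls {V W : GrModOver ℋ F} (h : GrK0.cls V = GrK0.cls W) (j : ι) (n : ℤ) :
    t.mult V j n = t.mult W j n := by
  let f : GrK0Over ℋ F →+ ℤ := GrK0.lift (fun V => (t.mult V j n : ℤ)) fun V' V V'' h => by
    simp only [t.mult_isExtension h, Nat.cast_add]
  have := congrArg f h
  simpa only [f, GrK0.lift_cls, Nat.cast_inj] using this

theorem cls_eq_of_cp (t : TestSystem ℋ F ι) {V W : GrModOver ℋ F}
    (h : ∀ x ∈ ℋ 0, ∀ i, V.cp ((1 : F) ⊗ₜ[A] x) i = W.cp ((1 : F) ⊗ₜ[A] x) i) :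
    GrK0.cls V = GrK0.cls W :=
  t.cls_eq_of_mult fun j n => by rw [mult, h _ (t.elt_mem j), mult]

theorem countP_eq_mult {V : GrModOver ℋ F} {l : List (GrModOver ℋ F)}
    (hl : HasGrCompFactors V l) (j : ι) (n : ℤ) [DecidablePred fun N => Iso N ((t.M j).shift n)] :
    l.countP (fun N => Iso N ((t.M j).shift n)) = t.mult V j n := by
  classical
  induction hl with
  | nil V h => rw [List.countP_nil, mult_of_subsingleton]
  | cons V' V M l hM h hl ih =>
    rw [List.countP_cons, ih, t.mult_isExtension h]
    congr 1
    obtain ⟨j', n', e⟩ := t.exhaust M hM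
    by_cases hi : Iso M ((t.M j).shift n)
    · rw [t.mult_iso hi, t.mult_M_shift]; simp [hi]
    · rw [t.mult_iso e, t.mult_M_shift, if_neg (by simpa using hi), if_neg]
      intro he
      obtain ⟨rfl, rfl⟩ := Prod.mk.inj he
      exact hi e

theorem isGrMultiplicity_iff {V : GrModOver ℋ F} {j : ι} {n : ℤ} {m : ℕ} :
    IsGrMultiplicity V ((t.M j).shift n) m ↔ m = t.mult V j n := by
  classical
  constructor
  · rintro ⟨-, l, hl, rfl⟩
    exact t.countP_eq_mult hl j n
  · rintro rfl
    obtain ⟨l, hl⟩ := V.exists_hasGrCompFactors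
    refine ⟨t.isGrSimple_shift j n, l, hl, ?_⟩
    exact t.countP_eq_mult hl j n

/-- Direct sums of shifts of the `M j`. -/
theorem exists_cp_eq_prod (a : Multiset (ι × ℤ)) : ∃ W : GrModOver ℋ F,
    ∀ s i, W.cp s i = (a.map fun p => ((t.M p.1).shift p.2).cp s i).prod := by
  induction a using Multiset.induction_on with
  | empty =>
    have : Subsingleton (zero fun i => (ℋ i).baseChange F).carrier :=
      inferInstanceAs (Subsingleton PUnit)
    exact ⟨zero _, fun s i => by rw [cp_of_subsingleton]; rfl⟩
  | cons p a ih =>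
    obtain ⟨W, hW⟩ := ih
    exact ⟨((t.M p.1).shift p.2).prod W, fun s i => by
      rw [(isExtension_prod _ W).cp_eq_mul, hW, Multiset.map_cons, Multiset.prod_cons]⟩

end TestSystem

/-! ### Construction of the test elements. -/

section Construction

variable {A H : Type u} [CommRing A] [Ring H] [Algebra A H] {ℋ : ℤ → Submodule A H}
  {F : Type u} [Field F] [Algebra A F] [GradedAlgebra ℋ] {ι : Type*}

/-- With `v` homogeneous of degree `i` and `ξ v ≠ 0`, Burnside's theorem gives an `s` acting on `M
j` as the rank-one map `x ↦ ξ(x_i) v` and as zero on the other simple modules. Passing to degree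
zero and clearing a denominator `a` leaves the simple eigenvalue `a ξ(v)` in degree `i` of `M j`,
and zero operators in every other case. -/
theorem IsGrIrrSystem.exists_elt [Finite ι] {M : ι → GrModOver ℋ F} (hM : IsGrIrrSystem M)
    (hs : IsSplitAlgebra F (F ⊗[A] H))
    (hF : ∀ x : F, ∃ a b : A, algebraMap A F b ≠ 0 ∧ algebraMap A F b * x = algebraMap A F a)
    (j : ι) : ∃ h ∈ ℋ 0, ∃ (c : F) (i : ℤ),
      ((M j).cp ((1 : F) ⊗ₜ[A] h) i).rootMultiplicity c = 1 ∧
      ∀ j' i', (j ≠ j' ∨ i' ≠ i) →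
        ((M j').cp ((1 : F) ⊗ₜ[A] h) i').rootMultiplicity c = 0 := by
  classical
  obtain ⟨i, v, hv, hv0⟩ := (M j).exists_homogeneous_ne_zero
    (have := hM.simple j; IsSimpleModule.nontrivial (F ⊗[A] H) _)
  obtain ⟨ξ, hξ⟩ : ∃ ξ : Module.Dual F (M j).carrier, ξ v ≠ 0 := by
    by_contra! h
    exact hv0 ((Module.forall_dual_apply_eq_zero_iff F v).1 h)
  let e : (M j).carrier →ₗ[F] (M j).carrier := (ξ ∘ₗ (M j).proj i).smulRight v
  let f : ∀ j', (M j').carrier →ₗ[F] (M j').carrier :=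
    Function.update 0 j e
  obtain ⟨s, hs⟩ := exists_smul_eq_of_isSimpleModule hM.simple (fun i j h => hM.unique i j h)
    (fun i f => hs _ (hM.simple i) f) f
  obtain ⟨s₀, hs₀, hs₀'⟩ := GrMod.exists_degree_zero (GrMod.iSup_baseChange ℋ F) s
  obtain ⟨a, ha, h, hh, hah⟩ := exists_smul_eq_tmul_one hF hs₀
  have hop : ∀ j' i' x, (M j').op ((1 : F) ⊗ₜ[A] h) i' x =
      -- Compressing `s` to a single degree is the same as applying its degree-zero part, and `h` is
      -- that part scaled by `a`.
      algebraMap A F a • (M j').proj i' (f j' ((M j').proj i' x)) := fun j' i' x => by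
    rw [GrMod.op_apply, ← hah, smul_assoc, ← hs₀' _ _ _ ((M j').proj_mem i' x), hs]
  have hc : algebraMap A F a * ξ v ≠ 0 := mul_ne_zero ha hξ
  refine ⟨h, hh, algebraMap A F a * ξ v, i, ?_, fun j' i' hji => ?_⟩
  · have h1 : (M j).op ((1 : F) ⊗ₜ[A] h) i =
        (algebraMap A F a • (ξ ∘ₗ (M j).proj i)).smulRight v := LinearMap.ext fun x => by
      rw [hop]
      simp [f, e, GrMod.proj_proj_same, (M j).proj_same hv, smul_smul, -algebraMap_smul]
    have h2 : algebraMap A F a * ξ v = (algebraMap A F a • (ξ ∘ₗ (M j).proj i)) v := by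
      simp [(M j).proj_same hv, -algebraMap_smul]
    rw [GrMod.cp, h1, h2]
    exact LinearMap.rootMultiplicity_charpoly_smulRight _ v (h2 ▸ hc)
  · have h1 : (M j').op ((1 : F) ⊗ₜ[A] h) i' = 0 := LinearMap.ext fun x => by
      rw [hop]
      by_cases hj : j' = j
      · subst hj
        have hi : i' ≠ i := by tauto
        simp [f, e, GrMod.proj_proj_ne _ hi]
      · simp [f, Function.update_of_ne hj]
    rw [GrMod.cp, h1]
    exact LinearMap.rootMultiplicity_charpoly_zero hc

theorem IsGrIrrSystem.exists_testSystem [Module.Finite A H] {M : ι → GrModOver ℋ F}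
    (hM : IsGrIrrSystem M) (hs : IsSplitAlgebra F (F ⊗[A] H))
    (hF : ∀ x : F, ∃ a b : A, algebraMap A F b ≠ 0 ∧ algebraMap A F b * x = algebraMap A F a) :
    ∃ t : TestSystem ℋ F ι, t.M = M := by
  have := hM.finite
  choose h hh c i h1 h2 using hM.exists_elt hs hF
  exact ⟨⟨M, hM.simple, fun T hT => hM.exists_iso_shift hT, h, hh, c, i, h1, h2⟩, rfl⟩

end Construction

/-! ### Extension of scalars from a split field. -/

namespace GrMod

variable {A H : Type u} [CommRing A] [Ring H] [Algebra A H] {ℋ : ℤ → Submodule A H}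
  {F : Type u} [Field F] [Algebra A F]
  (k : Type u) [Field k] [Algebra A k] [Algebra F k] [IsScalarTower A F k]

theorem exists_smul_tmul (V : GrModOver ℋ F) (s : F ⊗[A] H) :
    ∃ s' : k ⊗[A] H, ∀ (b : k) (v : V.carrier),
      s' • (show (V.baseChange k).carrier from b ⊗ₜ[F] v) = b ⊗ₜ[F] (s • v) := by
  induction s using TensorProduct.induction_on with
  | zero => exact ⟨0, fun b v => by rw [zero_smul, zero_smul, TensorProduct.tmul_zero]; rfl⟩
  | tmul l h =>
    refine ⟨algebraMap F k l ⊗ₜ[A] h, fun b v => ?_⟩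
    refine (V.baseChange_smul_tmul k _ b h v).trans ?_
    rw [← Algebra.smul_def, TensorProduct.smul_tmul, ← smul_assoc, TensorProduct.smul_tmul',
      smul_eq_mul, mul_one]
  | add s t hs ht =>
    obtain ⟨s', hs'⟩ := hs
    obtain ⟨t', ht'⟩ := ht
    exact ⟨s' + t', fun b v => by rw [add_smul, add_smul, TensorProduct.tmul_add, hs', ht']; rfl⟩

/-- A module on which the algebra acts through all endomorphisms stays simple under extension of
scalars. -/
theorem isSimpleModule_baseChange (V : GrModOver ℋ F) (hV : Nontrivial V.carrier)
    (hd : ∀ f : V.carrier →ₗ[F] V.carrier, ∃ s : F ⊗[A] H, ∀ v, s • v = f v) :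
    IsSimpleModule (k ⊗[A] H) (V.baseChange k).carrier := by
  classical
  have : Nontrivial (V.baseChange k).carrier := inferInstanceAs (Nontrivial (k ⊗[F] V.carrier))
  refine (isSimpleModule_iff _ _).2 ⟨fun N => or_iff_not_imp_left.2 fun hN => ?_⟩
  obtain ⟨x, hx, hx0⟩ := N.exists_mem_ne_zero_of_ne_bot hN
  let b := Module.finBasis F V.carrier
  let B : Module.Basis _ k (V.baseChange k).carrier := b.baseChange k
  have hB : ∀ i, B i = (1 : k) ⊗ₜ[F] b i := fun i => b.baseChange_apply k i
  obtain ⟨r, hr⟩ : ∃ r, B.repr x r ≠ 0 := by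
    by_contra! h
    exact hx0 (B.repr.map_eq_zero_iff.1 (Finsupp.ext h))
  -- The matrix unit sending `b r` to `b i` is realised over `F`, hence over `k`. Applied to `x` it
  -- isolates the nonzero coordinate `r` and yields a multiple of `B i`.
  have hmem : ∀ i, B i ∈ N := fun i => by
    obtain ⟨s, hs⟩ := hd ((b.coord r).smulRight (b i))
    obtain ⟨s', hs'⟩ := exists_smul_tmul k V s
    have h1 : ∀ y, s' • y = B.repr y r • B i := fun y => by
      have : Algebra.lsmul k k (V.baseChange k).carrier s' = (B.coord r).smulRight (B i) := by
        refine B.ext fun m => ?_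
        change s' • B m = B.repr (B m) r • B i
        rw [hB]
        refine (hs' 1 (b m)).trans ?_
        rw [hs, ← hB, B.repr_self, hB]
        change (1 : k) ⊗ₜ[F] (b.repr (b m) r • b i) = _
        rw [b.repr_self, Finsupp.single_apply, Finsupp.single_apply]
        split_ifs with h
        · rw [one_smul]; exact (one_smul k _).symm
        · rw [zero_smul, TensorProduct.tmul_zero]; exact (zero_smul k _).symm
      exact LinearMap.congr_fun this y
    have h2 : (B.repr x r)⁻¹ • (s' • x) ∈ N :=
      (N.restrictScalars k).smul_mem _ (N.smul_mem s' hx)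
    rwa [h1, smul_smul, inv_mul_cancel₀ hr, one_smul] at h2
  refine (Submodule.restrictScalars_eq_top_iff k _ _).1 (eq_top_iff.2 ?_)
  rw [← B.span_eq, Submodule.span_le]
  rintro _ ⟨i, rfl⟩
  exact hmem i

theorem HasGrCompFactors.baseChange {V : GrModOver ℋ F} {l : List (GrModOver ℋ F)}
    (h : HasGrCompFactors V l) (hl : ∀ M ∈ l, (M.baseChange k).IsGrSimple) :
    HasGrCompFactors (V.baseChange k) (l.map fun M => M.baseChange k) := by
  induction h with
  | nil V h => exact .nil _ (inferInstanceAs (Subsingleton (k ⊗[F] V.carrier)))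
  | cons V' V M l hM h hl' ih =>
    exact .cons _ _ _ _ (hl M (by simp)) (h.baseChange k)
      (ih fun N hN => hl N (List.mem_cons_of_mem _ hN))

theorem Iso.baseChange {V W : GrModOver ℋ F} (h : Iso V W) :
    Iso (V.baseChange k) (W.baseChange k) := by
  obtain ⟨f, hf, hb⟩ := h
  refine ⟨baseChangeMap f k, fun i => map_mem_baseChange k (f.restrictScalars F) (hf i), ?_, ?_⟩
  · exact Module.Flat.lTensor_preserves_injective_linearMap (M := k) (f.restrictScalars F) hb.1
  · exact LinearMap.lTensor_surjective k (g := f.restrictScalars F) hb.2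

/-- Makes the canonical isomorphism `k ⊗ FH ≅ kH` linear over `kH`, so that maps out of the regular
module are available after base change. -/
theorem cancelBaseChange_baseChangeRep (s : k ⊗[A] H) (y : k ⊗[F] (F ⊗[A] H)) :
    TensorProduct.AlgebraTensorModule.cancelBaseChange A F k k H
        (baseChangeRep F H k (F ⊗[A] H) s y) =
      s * TensorProduct.AlgebraTensorModule.cancelBaseChange A F k k H y := by
  induction s using TensorProduct.induction_on with
  | zero => simp
  | add s t hs ht => rw [map_add, LinearMap.add_apply, map_add, hs, ht, add_mul]
  | tmul a h =>
    induction y using TensorProduct.induction_on with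
    | zero => simp
    | add y z hy hz => simp only [map_add, hy, hz, mul_add]
    | tmul b z =>
      rw [baseChangeRep_tmul, smul_eq_mul]
      induction z using TensorProduct.induction_on with
      | zero => simp
      | add y z hy hz => simp only [mul_add, TensorProduct.tmul_add, map_add, hy, hz]
      | tmul c h' =>
        rw [Algebra.TensorProduct.tmul_mul_tmul, one_mul,
          TensorProduct.AlgebraTensorModule.cancelBaseChange_tmul,
          TensorProduct.AlgebraTensorModule.cancelBaseChange_tmul,
          Algebra.TensorProduct.tmul_mul_tmul, mul_smul_comm]

theorem exists_ne_zero_of_reg [GradedAlgebra ℋ] [Module.Finite A H] {T : Type*} [AddCommGroup T]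
    [Module (k ⊗[A] H) T] [Nontrivial T] :
    ∃ f : ((reg ℋ F).baseChange k).carrier →ₗ[k ⊗[A] H] T, f ≠ 0 := by
  obtain ⟨x, hx⟩ := exists_ne (0 : T)
  let e : ((reg ℋ F).baseChange k).carrier →ₗ[k] k ⊗[A] H :=
    (TensorProduct.AlgebraTensorModule.cancelBaseChange A F k k H).toLinearMap
  have hs : ∀ (s : k ⊗[A] H) y, e (s • y) = s * e y := cancelBaseChange_baseChangeRep k
  let f : ((reg ℋ F).baseChange k).carrier →ₗ[k ⊗[A] H] T :=
    { toFun := fun y => e y • x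
      map_add' := fun y z => by rw [map_add, add_smul]
      map_smul' := fun s y => by rw [hs, mul_smul]; rfl }
  refine ⟨f, fun h => hx ?_⟩
  have h1 : f ((1 : k) ⊗ₜ[F] ((1 : F) ⊗ₜ[A] (1 : H))) = x := by
    change TensorProduct.AlgebraTensorModule.cancelBaseChange A F k k H
      ((1 : k) ⊗ₜ[F] ((1 : F) ⊗ₜ[A] (1 : H))) • x = x
    rw [TensorProduct.AlgebraTensorModule.cancelBaseChange_tmul, one_smul,
      ← Algebra.TensorProduct.one_def, one_smul]
  rw [← h1, h]
  rfl

end GrMod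

namespace TestSystem

open GrMod

variable {A H : Type u} [CommRing A] [Ring H] [Algebra A H] {ℋ : ℤ → Submodule A H}
  {F : Type u} [Field F] [Algebra A F] {ι : Type*} (t : TestSystem ℋ F ι)
  (k : Type u) [Field k] [Algebra A k] [Algebra F k] [IsScalarTower A F k]

theorem isSimpleModule_baseChange_of_isSplitAlgebra [GradedAlgebra ℋ] (hs : IsSplitAlgebra F (F ⊗[A] H))
    {V : GrModOver ℋ F} (hV : IsSimpleModule (F ⊗[A] H) V.carrier) :
    IsSimpleModule (k ⊗[A] H) (V.baseChange k).carrier :=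
  V.isSimpleModule_baseChange k (IsSimpleModule.nontrivial (F ⊗[A] H) _)
    (hs.exists_smul_eq hV)

/-- Extension of scalars of a test system. -/
noncomputable def baseChange [GradedAlgebra ℋ] [Module.Finite A H]
    (hs : IsSplitAlgebra F (F ⊗[A] H)) : TestSystem ℋ k ι where
  M j := (t.M j).baseChange k
  simple j := isSimpleModule_baseChange_of_isSplitAlgebra k hs (t.simple j)
  exhaust T hT := by
    have h𝒮 := iSup_baseChange ℋ F
    have h𝒮' := iSup_baseChange ℋ k
    have hT' := hT.isSimpleModule h𝒮'
    have := IsSimpleModule.nontrivial (k ⊗[A] H) T.carrier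
    -- A simple `T` over `k` receives a nonzero map from the extended regular module, whose factors
    -- are the extensions of the factors over `F` because splitness keeps them simple. No new simple
    -- modules appear.
    obtain ⟨l, hl⟩ := (reg ℋ F).exists_hasGrCompFactors
    obtain ⟨f, hf⟩ := exists_ne_zero_of_reg (ℋ := ℋ) (F := F) k (T := T.carrier)
    have hl' := hl.baseChange k fun M hM => isGrSimple_of_isSimpleModule
      (isSimpleModule_baseChange_of_isSplitAlgebra k hs ((hl.isGrSimple M hM).isSimpleModule h𝒮))
    obtain ⟨N', hN', ⟨e⟩⟩ := hl'.exists_linearEquiv h𝒮' f hf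
    obtain ⟨N, hN, rfl⟩ := List.mem_map.1 hN'
    obtain ⟨j, n, h⟩ := t.exhaust N (hl.isGrSimple N hN)
    obtain ⟨g, -, hg⟩ := h.baseChange k
    have he : UngradedIso T ((t.M j).baseChange k) := ⟨e.symm.trans (LinearEquiv.ofBijective g hg)⟩
    obtain ⟨m, hm⟩ := hT.exists_iso_shift h𝒮'
      (isGrSimple_of_isSimpleModule (isSimpleModule_baseChange_of_isSplitAlgebra k hs (t.simple j))) he
    exact ⟨j, m, hm⟩
  elt := t.elt
  elt_mem := t.elt_mem
  eig j := algebraMap F k (t.eig j)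
  pos := t.pos
  rootMultiplicity_pos j := by
    rw [cp_baseChange, ← Polynomial.eq_rootMultiplicity_map (algebraMap F k).injective]
    exact t.rootMultiplicity_pos j
  rootMultiplicity_of_ne j j' i h := by
    rw [cp_baseChange, ← Polynomial.eq_rootMultiplicity_map (algebraMap F k).injective]
    exact t.rootMultiplicity_of_ne j j' i h

variable [GradedAlgebra ℋ] [Module.Finite A H] (hs : IsSplitAlgebra F (F ⊗[A] H))

theorem mult_baseChange (V : GrModOver ℋ F) (j : ι) (n : ℤ) :
    (t.baseChange k hs).mult (V.baseChange k) j n = t.mult V j n := by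
  rw [mult, cp_baseChange]
  exact (Polynomial.eq_rootMultiplicity_map (algebraMap F k).injective _).symm

include t hs in
-- Extension to `k` preserves all multiplicities, so it is injective on classes of modules. Only
-- such classes are compared, which is why positivity enters the uniqueness of the decomposition
-- map.
theorem cls_eq_of_baseChange {V W : GrModOver ℋ F}
    (h : GrK0.cls (V.baseChange k) = GrK0.cls (W.baseChange k)) : GrK0.cls V = GrK0.cls W :=
  t.cls_eq_of_mult fun j n => by
    rw [← t.mult_baseChange k hs, ← t.mult_baseChange k hs, mult_eq_of_cls _ h]

/-- `W` is the direct sum over `F` of the shifted simple modules with the labels of the factors of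
`V`. It need not be a form of `V`; only the characteristic polynomials have to agree. -/
theorem exists_descent (hs : IsSplitAlgebra F (F ⊗[A] H)) (t : TestSystem ℋ F ι)
    (V : GrModOver ℋ k) : ∃ W : GrModOver ℋ F, ∀ (x : H) (i : ℤ),
      (W.cp ((1 : F) ⊗ₜ[A] x) i).map (algebraMap F k) = V.cp ((1 : k) ⊗ₜ[A] x) i := by
  obtain ⟨a, -, -, h⟩ := (t.baseChange k hs).exists_labels V
  obtain ⟨W, hW⟩ := t.exists_cp_eq_prod a
  refine ⟨W, fun x i => ?_⟩
  rw [hW, h, Polynomial.map_multiset_prod, Multiset.map_map]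
  refine congrArg _ (Multiset.map_congr rfl fun p _ => ?_)
  exact (cp_baseChange ((t.M p.1).shift p.2) k x i).symm

end TestSystem

/-! ### Graded lattices over valuation rings. -/

section Lattice

variable {A H : Type u} [CommRing A] [Ring H] [Algebra A H] {ℋ : ℤ → Submodule A H}

/-- `X` consists of the homogeneous components of finitely many generators, so a projection maps
each of its elements to itself or to zero. -/
theorem GrMod.exists_homogeneous_spanning {R S : Type u} [CommRing R] [Ring S] [Algebra R S]
    {𝒮 : ℤ → Submodule R S} (V : GrMod 𝒮) :
    ∃ X : Set V.carrier, X.Finite ∧ (∀ i, ∀ x ∈ X, V.proj i x ∈ X ∪ {0}) ∧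
      Submodule.span R X = ⊤ := by
  classical
  obtain ⟨t, ht⟩ := Module.Finite.fg_top (R := R) (M := V.carrier)
  obtain ⟨s, hs⟩ := V.exists_support
  refine ⟨(fun p : ℤ × V.carrier => V.proj p.1 p.2) '' (s ×ˢ t : Finset (ℤ × V.carrier)),
    (Finset.finite_toSet _).image _, ?_, ?_⟩
  · rintro i _ ⟨⟨j, v⟩, hp, rfl⟩
    by_cases hij : j = i
    · subst hij
      exact Or.inl ⟨(j, v), hp, (V.proj_proj_same _ _).symm⟩
    · exact Or.inr (V.proj_proj_ne hij v)
  · rw [eq_top_iff, ← ht, Submodule.span_le]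
    intro v hv
    rw [← V.sum_proj hs v]
    exact sum_mem fun i hi => Submodule.subset_span
      ⟨(i, v), Finset.mem_coe.2 (Finset.mem_product.2 ⟨hi, hv⟩), rfl⟩

variable {O K : Type u} [CommRing O] [IsDomain O] [Algebra A O] [Field K] [Algebra A K]
  [Algebra O K] [IsScalarTower A O K] [IsFractionRing O K]

theorem exists_smul_eq_one_tmul {M : Type*} [AddCommGroup M] [Module O M] (y : K ⊗[O] M) :
    ∃ c : O, c ≠ 0 ∧ ∃ x : M, algebraMap O K c • y = (1 : K) ⊗ₜ[O] x := by
  have key : ∀ (a : O) (h : M), algebraMap O K a • ((1 : K) ⊗ₜ[O] h) = (1 : K) ⊗ₜ[O] (a • h) :=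
    fun a h => by rw [TensorProduct.smul_tmul', TensorProduct.tmul_smul, TensorProduct.smul_tmul',
      smul_eq_mul, mul_one, Algebra.smul_def, mul_one]
  induction y using TensorProduct.induction_on with
  | zero => exact ⟨1, one_ne_zero, 0, by simp⟩
  | tmul a m =>
    obtain ⟨⟨p, q⟩, hpq⟩ := IsLocalization.surj (nonZeroDivisors O) a
    refine ⟨q, nonZeroDivisors.ne_zero q.2, p • m, ?_⟩
    rw [← key, TensorProduct.smul_tmul', TensorProduct.smul_tmul', smul_eq_mul, smul_eq_mul,
      mul_one, mul_comm, hpq]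
  | add x y hx hy =>
    obtain ⟨c, hc, m, h⟩ := hx
    obtain ⟨c', hc', m', h'⟩ := hy
    refine ⟨c' * c, mul_ne_zero hc' hc, c' • m + c • m', ?_⟩
    rw [TensorProduct.tmul_add, ← key, ← key, ← h, ← h', smul_smul, smul_smul, ← map_mul,
      ← map_mul, smul_add, mul_comm c c']

/-- Every graded module over the field of fractions of a valuation ring has a graded lattice. -/
theorem GrMod.exists_lattice [ValuationRing O] [GradedAlgebra ℋ] [Module.Finite A H]
    (V : GrModOver ℋ K) :
    ∃ Λ : GrModOver ℋ O, Module.Free O Λ.carrier ∧ Iso (Λ.baseChange K) V := by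
  classical
  let ψ : (O ⊗[A] H) →ₐ[O] (K ⊗[A] H) :=
    Algebra.TensorProduct.map (Algebra.ofId O K) (AlgHom.id A H)
  have hψ : ∀ a h, ψ (a ⊗ₜ[A] h) = algebraMap O K a ⊗ₜ[A] h := fun a h => by
    simp [ψ, Algebra.ofId_apply]
  have hψd : ∀ d, ∀ s ∈ (ℋ d).baseChange O, ψ s ∈ (ℋ d).baseChange K := fun d s hs => by
    rw [Submodule.baseChange_eq_span] at hs
    induction hs using Submodule.span_induction with
    | zero => rw [map_zero]; exact zero_mem _
    | add x y _ _ hx hy => rw [map_add]; exact add_mem hx hy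
    | smul a x _ hx =>
      rw [map_smul, ← algebraMap_smul K]; exact Submodule.smul_mem _ _ hx
    | mem x hx =>
      obtain ⟨w, hw, rfl⟩ := hx
      rw [TensorProduct.mk_apply, hψ]
      exact Submodule.tmul_mem_baseChange_of_mem _ hw
  let _ : Module O V.carrier := Module.compHom _ (algebraMap O K)
  have : IsScalarTower O K V.carrier := ⟨fun a b v => by
    rw [Algebra.smul_def, mul_smul]; rfl⟩
  have : IsScalarTower O (K ⊗[A] H) V.carrier := ⟨fun a s v => by
    rw [← algebraMap_smul K a s, ← algebraMap_smul K a (s • v), smul_assoc]⟩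
  let _ : Module (O ⊗[A] H) V.carrier := Module.compHom _ ψ.toRingHom
  have hsm : ∀ (s : O ⊗[A] H) (v : V.carrier), s • v = ψ s • v := fun s v => rfl
  have : IsScalarTower O (O ⊗[A] H) V.carrier := ⟨fun a s v => by
    rw [hsm, hsm, map_smul, smul_assoc]⟩
  obtain ⟨X, hX, hXp, hXs⟩ := V.exists_homogeneous_spanning
  -- The lattice is the `OH`-span of the homogeneous set `X`: graded because `X` is stable under
  -- projections up to zero, and finite over `O` because `OH` is.
  let N : Submodule (O ⊗[A] H) V.carrier := Submodule.span _ X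
  have hN : ∀ i, ∀ v ∈ N, V.proj i v ∈ N := fun i v hv => by
    induction hv using Submodule.span_induction generalizing i with
    | zero => rw [map_zero]; exact zero_mem _
    | add x y _ _ hx hy => rw [map_add]; exact add_mem (hx i) (hy i)
    | mem x hx =>
      rcases hXp i x hx with h | h
      · exact Submodule.subset_span h
      · rw [Set.mem_singleton_iff.1 h]; exact zero_mem _
    | smul s x _ hx =>
      induction s using mem_of_homogeneous (iSup_baseChange ℋ O) with
      | add s t hs ht => rw [add_smul, map_add]; exact add_mem hs ht
      | hom d s hs =>
        have := V.proj_smul (hψd d s hs) (i - d) x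
        rw [add_sub_cancel, ← hsm, ← hsm] at this
        rw [this]
        exact N.smul_mem s (hx _)
  have hfin1 : Module.Finite (O ⊗[A] H) N := Module.Finite.iff_fg.2 (Submodule.fg_span hX)
  have hfin : Module.Finite O N := Module.Finite.trans (O ⊗[A] H) N
  let Λ : GrModOver ℋ O :=
    { carrier := N
      finite := hfin
      deg := fun i => ((V.deg i).restrictScalars O).comap ((N.subtype).restrictScalars O)
      isInternal := by
        refine isInternal_of_proj (p := fun i => ((V.proj i).restrictScalars O).restrict
          (p := N.restrictScalars O) (q := N.restrictScalars O) (hN i)) ?_ ?_ ?_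
        · exact fun i v hv => Subtype.ext (V.proj_same hv)
        · exact fun i j hij v hv => Subtype.ext (V.proj_ne hv hij)
        · refine eq_top_iff.2 fun v _ => ?_
          obtain ⟨s, hs⟩ := V.exists_support
          have : v = ∑ i ∈ s, (⟨V.proj i v, hN i v v.2⟩ : N) := by
            apply Subtype.ext
            rw [AddSubmonoidClass.coe_finsetSum]
            exact (V.sum_proj hs v).symm
          rw [this]
          exact sum_mem fun i _ => Submodule.mem_iSup_of_mem i (V.proj_mem i v)
      smul_mem := fun i j s v hs hv => V.smul_mem i j (ψ s) v (hψd i s hs) hv }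
  -- Over a valuation ring torsion-free modules are flat, and finite flat modules over a local ring
  -- are free.
  have hflat : Module.Flat O N := by
    refine Module.Flat.flat_iff_torsion_eq_bot_of_isBezout.2 ?_
    rw [eq_bot_iff]
    rintro x ⟨⟨a, ha⟩, hax⟩
    have h1 : algebraMap O K a • (x : V.carrier) = 0 := congrArg Subtype.val hax
    have h2 : algebraMap O K a ≠ 0 := fun h => nonZeroDivisors.ne_zero ha
      ((IsFractionRing.injective O K) (h.trans (map_zero _).symm))
    exact Subtype.ext ((smul_eq_zero.1 h1).resolve_left h2)
  refine ⟨Λ, Module.free_of_flat_of_isLocalRing (R := O) (P := N), ?_⟩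
  let f₀ : K ⊗[O] N →ₗ[K] V.carrier := LinearMap.liftBaseChange K (N.subtype.restrictScalars O)
  have hf₀ : ∀ a (x : N), f₀ (a ⊗ₜ[O] x) = a • (x : V.carrier) := fun a x =>
    LinearMap.liftBaseChange_tmul ..
  have hlin : ∀ (s : K ⊗[A] H) (y : K ⊗[O] N), f₀ (baseChangeRep O H K N s y) = s • f₀ y := by
    intro s y
    induction s using TensorProduct.induction_on with
    | zero => simp
    | add s t hs ht => rw [map_add, LinearMap.add_apply, map_add, hs, ht, add_smul]
    | tmul a h =>
      induction y using TensorProduct.induction_on with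
      | zero => simp
      | add y z hy hz => simp only [map_add, hy, hz, smul_add]
      | tmul b z =>
        rw [baseChangeRep_tmul, hf₀, hf₀]
        change (a * b) • (ψ ((1 : O) ⊗ₜ[A] h) • (z : V.carrier)) = _
        rw [hψ, map_one, ← smul_assoc, smul_comm (a ⊗ₜ[A] h) b, ← smul_assoc,
          TensorProduct.smul_tmul', TensorProduct.smul_tmul', smul_eq_mul, smul_eq_mul, mul_one,
          mul_comm]
  let f : (Λ.baseChange K).carrier →ₗ[K ⊗[A] H] V.carrier :=
    { toFun := f₀
      map_add' := map_add f₀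
      map_smul' := hlin }
  -- After clearing denominators `y` becomes `1 ⊗ x` with `x` in `N`, a submodule of `V`.
  have hinj : ∀ y : K ⊗[O] N, f₀ y = 0 → y = 0 := by
    intro y hy
    obtain ⟨c, hc, x, hx⟩ := exists_smul_eq_one_tmul (O := O) (K := K) (M := N) y
    have hc' : algebraMap O K c ≠ 0 := fun h => hc
      ((IsFractionRing.injective O K) (h.trans (map_zero _).symm))
    have h1 : f₀ (algebraMap O K c • y) = 0 :=
      (map_smul f₀ _ _).trans ((congrArg _ hy).trans (smul_zero _))
    rw [hx, hf₀, one_smul] at h1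
    have h2 : x = 0 := Subtype.ext h1
    rw [h2, TensorProduct.tmul_zero] at hx
    exact (smul_eq_zero.1 hx).resolve_left hc'
  refine ⟨f, fun i v hv => ?_, ?_, ?_⟩
  · have hv' : v ∈ (Λ.deg i).baseChange K := hv
    clear hv
    rw [Submodule.baseChange_eq_span] at hv'
    induction hv' using Submodule.span_induction with
    | zero => exact (map_zero f₀).symm ▸ zero_mem (V.deg i)
    | add x y _ _ hx hy => exact (map_add f₀ x y).symm ▸ add_mem hx hy
    | smul a x _ hx => exact (map_smul f₀ a x).symm ▸ (V.deg i).smul_mem a hx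
    | mem x hx =>
      obtain ⟨w, hw, rfl⟩ := hx
      have : f₀ ((1 : K) ⊗ₜ[O] w) = (w : V.carrier) := by rw [hf₀, one_smul]
      exact this.symm ▸ hw
  · exact (injective_iff_map_eq_zero f).2 hinj
  · have : LinearMap.range f₀ = ⊤ := by
      rw [eq_top_iff, ← hXs, Submodule.span_le]
      intro x hx
      exact ⟨(1 : K) ⊗ₜ[O] (⟨x, Submodule.subset_span hx⟩ : N), by rw [hf₀, one_smul]⟩
    exact (LinearMap.range_eq_top.1 this : Function.Surjective f₀)

end Lattice

/-! ### Modular systems and reduction of characteristic polynomials. -/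

section Reduction

variable {A H : Type u} [CommRing A] [Ring H] [Algebra A H] {ℋ : ℤ → Submodule A H}
  {C K L : Type u} [CommRing C] [Algebra A C] [Field K] [Algebra A K] [Algebra C K]
  [Field L] [Algebra A L]

/-- Localise `C` at `ker σ` and dominate the result by a valuation ring of `K`. The residue field
contains `C / ker σ ≅ σ(C)`, hence its field of fractions `L`. -/
theorem ModularSystem.nonempty [IsScalarTower A C K] [IsDomain C] [IsFractionRing C K]
    (σ : C →ₐ[A] L)
    (hσ : ∀ x : L, ∃ a b : C, σ b ≠ 0 ∧ σ b * x = σ a) :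
    Nonempty (ModularSystem A C K L σ) := by
  let P : Ideal C := RingHom.ker σ
  have hP : P.IsPrime := RingHom.ker_isPrime σ
  have hle : P.primeCompl ≤ nonZeroDivisors C := P.primeCompl_le_nonZeroDivisors
  have hinj : Function.Injective (algebraMap C K) := IsFractionRing.injective C K
  let f : Localization.AtPrime P →+* K := IsLocalization.lift (M := P.primeCompl)
    (g := algebraMap C K) fun y => by
      rw [isUnit_iff_ne_zero, Ne, map_eq_zero_iff _ hinj]
      exact nonZeroDivisors.ne_zero (hle y.2)
  -- Locality of the map into `O` gives that the maximal ideal of `O` contracts to `P` in `C`.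
  obtain ⟨O, hO, hloc⟩ := IsLocalRing.exists_factor_valuationRing f
  let g : C →+* O := (f.codRestrict O.toSubring hO).comp (algebraMap C (Localization.AtPrime P))
  have hg : ∀ c, algebraMap O K (g c) = algebraMap C K c := fun c =>
    IsLocalization.lift_eq (M := P.primeCompl) _ c
  have hmem : ∀ c, g c ∈ IsLocalRing.maximalIdeal O ↔ σ c = 0 := fun c => by
    rw [IsLocalRing.mem_maximalIdeal, mem_nonunits_iff]
    have h1 : IsUnit (g c) ↔ IsUnit (algebraMap C (Localization.AtPrime P) c) :=
      isUnit_map_iff (f.codRestrict O.toSubring hO) _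
    rw [h1, IsLocalization.AtPrime.isUnit_to_map_iff _ P, Ideal.mem_primeCompl_iff, not_not]
    rfl
  let _ : Algebra A O := (g.comp (algebraMap A C)).toAlgebra
  have hAO : ∀ a, algebraMap A O a = g (algebraMap A C a) := fun a => rfl
  have tK : IsScalarTower A O K := IsScalarTower.of_algebraMap_eq fun a => by
    rw [hAO, hg, ← IsScalarTower.algebraMap_apply]
  have hfr : IsFractionRing σ.toRingHom.range L := by
    refine IsFractionRing.of_field _ _ fun x => ?_
    obtain ⟨a, b, hb, hab⟩ := hσ x
    refine ⟨⟨σ a, a, rfl⟩, ⟨σ b, b, rfl⟩, ?_⟩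
    exact (eq_div_iff hb).2 ((mul_comm _ _).trans hab)
  let r : C →+* IsLocalRing.ResidueField O := (IsLocalRing.residue O).comp g
  have hr : ∀ c, r c = 0 ↔ σ c = 0 := fun c => by
    rw [← hmem]
    exact IsLocalRing.residue_eq_zero_iff _
  let q := Ideal.Quotient.lift (RingHom.ker σ.toRingHom) r fun c hc => (hr c).2 hc
  let r' : σ.toRingHom.range →+* IsLocalRing.ResidueField O :=
    q.comp (RingHom.quotientKerEquivRange σ.toRingHom).symm.toRingHom
  have hr' : ∀ c, r' ⟨σ c, c, rfl⟩ = r c := fun c => by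
    have : (RingHom.quotientKerEquivRange σ.toRingHom).symm ⟨σ c, c, rfl⟩ =
        Ideal.Quotient.mk _ c := by
      rw [RingEquiv.symm_apply_eq]; rfl
    exact (congrArg q this).trans rfl
  have hr'i : Function.Injective r' := by
    rw [injective_iff_map_eq_zero]
    rintro ⟨_, c, rfl⟩ hc
    exact Subtype.ext ((hr c).1 ((hr' c).symm.trans hc))
  let algL : Algebra L (IsLocalRing.ResidueField O) :=
    (IsFractionRing.lift hr'i : L →+* IsLocalRing.ResidueField O).toAlgebra
  have hL : ∀ c, r c = algebraMap L (IsLocalRing.ResidueField O) (σ c) := fun c => by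
    rw [← hr' c]
    exact (IsFractionRing.lift_algebraMap hr'i ⟨σ c, c, rfl⟩).symm
  exact ⟨{
    O := O
    incl := { g with commutes' := fun a => rfl }
    incl_spec := hg
    mem_maximalIdeal_iff := hmem
    towerL := IsScalarTower.of_algebraMap_eq fun a => by
      rw [← AlgHom.commutes σ a, ← hL]
      rfl
    residue_incl := hL }⟩

/-- Characteristic polynomials of elements of `H` have coefficients in an integrally closed base. -/
theorem GrMod.exists_map_eq_cp [IsScalarTower A C K] [GradedAlgebra ℋ] [Module.Finite A H]
    (hC : IsIntegrallyClosedIn C K) (V : GrModOver ℋ K) (x : H) (i : ℤ) :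
    ∃ P : Polynomial C, P.map (algebraMap C K) = V.cp ((1 : K) ⊗ₜ[A] x) i := by
  rw [← Polynomial.mem_lifts, Polynomial.lifts_iff_coeff_lifts]
  intro n
  by_contra hn
  let R : Subring K := (algebraMap C K).range
  have hR : IsIntegrallyClosedIn R K := by
    rw [isIntegrallyClosedIn_iff]
    refine ⟨Subtype.val_injective, fun {y} hy => ?_⟩
    let _ : Algebra C R := (algebraMap C K).rangeRestrict.toAlgebra
    have : IsScalarTower C R K := IsScalarTower.of_algebraMap_eq fun c => rfl
    have : Algebra.IsIntegral C R :=
      Algebra.isIntegral_of_surjective (algebraMap C K).rangeRestrict_surjective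
    obtain ⟨c, hc⟩ := hC.isIntegral_iff.1 (isIntegral_trans (R := C) y hy)
    exact ⟨⟨y, c, hc⟩, rfl⟩
  -- A coefficient outside the integrally closed ring `R` is missed by some valuation ring `O`
  -- containing `R`; yet a lattice over `O` computes the same polynomial with coefficients in `O`.
  obtain ⟨O, hO, hxO⟩ := Subring.exists_le_valuationSubring_of_isIntegrallyClosedIn (R := R) hn
  let g : A →+* O := (algebraMap A K).codRestrict O.toSubring fun a =>
    hO ⟨algebraMap A C a, (IsScalarTower.algebraMap_apply A C K a).symm⟩
  let _ : Algebra A O := g.toAlgebra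
  have : IsScalarTower A O K := IsScalarTower.of_algebraMap_eq fun a => rfl
  obtain ⟨Λ, hΛ, e⟩ := GrMod.exists_lattice (O := O) V
  refine hxO ?_
  rw [← e.cp_eq, cp_baseChange, Polynomial.coeff_map]
  exact ((Λ.cp _ i).coeff n).2

/-- `W` has the characteristic polynomials of a modular reduction of `V` along `σ`. -/
def IsReduction (σ : C →ₐ[A] L) (V : GrModOver ℋ K) (W : GrModOver ℋ L) : Prop :=
  ∀ (x : H) (i : ℤ) (P : Polynomial C), P.map (algebraMap C K) = V.cp ((1 : K) ⊗ₜ[A] x) i →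
    P.map (σ : C →+* L) = W.cp ((1 : L) ⊗ₜ[A] x) i

/-- As `O` embeds in `K`, the image of `P` in `O` is the polynomial of the lattice itself. Reducing
modulo the maximal ideal then acts on `P` through `σ`, so the outcome depends on neither `O` nor the
lattice beyond `P`. -/
theorem ModularSystem.map_eq_cp {σ : C →ₐ[A] L}
    (s : ModularSystem A C K L σ) (Λ : GrModOver ℋ s.O) [Module.Free s.O Λ.carrier]
    (x : H) (i : ℤ) {P : Polynomial C}
    (hP : P.map (algebraMap C K) = (Λ.baseChange K).cp ((1 : K) ⊗ₜ[A] x) i) :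
    (P.map (σ : C →+* L)).map (algebraMap L s.k) =
      (Λ.baseChange s.k).cp ((1 : s.k) ⊗ₜ[A] x) i := by
  have h1 : (algebraMap s.O K).comp (s.incl : C →+* s.O) = algebraMap C K :=
    RingHom.ext s.incl_spec
  have h2 : P.map (s.incl : C →+* s.O) = Λ.cp ((1 : s.O) ⊗ₜ[A] x) i := by
    apply Polynomial.map_injective _ (IsFractionRing.injective s.O K)
    rw [Polynomial.map_map, h1, hP, GrMod.cp_baseChange]
  have h3 : (algebraMap L s.k).comp (σ : C →+* L) =
      (algebraMap s.O s.k).comp (s.incl : C →+* s.O) :=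
    RingHom.ext fun c => (s.residue_incl c).symm
  rw [GrMod.cp_baseChange, ← h2, Polynomial.map_map, Polynomial.map_map, h3]

end Reduction

/-! ### Grothendieck groups and Laurent polynomial bookkeeping. -/

section GrothendieckGroup

variable {R S : Type u} [CommRing R] [Ring S] [Algebra R S] {𝒮 : ℤ → Submodule R S}

theorem GrK0.hom_ext {G : Type*} [AddCommGroup G] {f g : GrK0 𝒮 →+ G}
    (h : ∀ V, f (GrK0.cls V) = g (GrK0.cls V)) : f = g :=
  QuotientAddGroup.addMonoidHom_ext _ (FreeAbelianGroup.lift_ext _ _ h)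

theorem GrMod.Iso.cls_eq {V W : GrMod 𝒮} (h : GrMod.Iso V W) : GrK0.cls V = GrK0.cls W := by
  have hz := GrK0.cls_eq_add (GrMod.Iso.refl (GrMod.zero 𝒮)).isExtension
  rw [GrK0.cls_eq_add h.isExtension, left_eq_add.1 hz, zero_add]

theorem GrK0.qPow_cls (j : ℤ) (V : GrMod 𝒮) : GrK0.qPow j (GrK0.cls V) = GrK0.cls (V.shift j) :=
  GrK0.lift_cls _ _ _

end GrothendieckGroup

section LaurentPolynomial

open Classical in
/-- The Laurent polynomials counting the shifts that occur in a multiset. -/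
noncomputable def labelPoly {ι : Type*} (a : Multiset (ι × ℤ)) (j : ι) : ℕ[T;T⁻¹] :=
  (a.map fun p => if p.1 = j then LaurentPolynomial.T p.2 else 0).sum

open Classical in
theorem coeff_labelPoly {ι : Type*} (a : Multiset (ι × ℤ)) (j : ι) (n : ℤ) :
    (labelPoly a j).coeff n = a.count (j, n) := by
  induction a using Multiset.induction_on with
  | empty => simp [labelPoly]
  | cons p a ih =>
    rw [labelPoly, Multiset.map_cons, Multiset.sum_cons, AddMonoidAlgebra.coeff_add,
      Finsupp.add_apply, Multiset.count_cons, add_comm]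
    refine congrArg₂ (· + ·) ih ?_
    obtain ⟨j', m⟩ := p
    by_cases hj : j' = j
    · subst hj
      simp [eq_comm]
    · simp [hj, Ne.symm hj]

theorem sum_labelPoly_mul {ι : Type*} [Fintype ι] (a : Multiset (ι × ℤ)) (E : ι → ℕ[T;T⁻¹])
    (n : ℤ) : (∑ j, labelPoly a j * E j).coeff n =
      (a.map fun p => (E p.1).coeff (n - p.2)).sum := by
  classical
  induction a using Multiset.induction_on with
  | empty => simp [labelPoly]
  | cons p a ih =>
    have h : ∀ j, labelPoly (p ::ₘ a) j =
        (if p.1 = j then LaurentPolynomial.T p.2 else 0) + labelPoly a j := fun j => by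
      simp only [labelPoly, Multiset.map_cons, Multiset.sum_cons]
    simp only [h, add_mul, Finset.sum_add_distrib, AddMonoidAlgebra.coeff_add, Finsupp.add_apply,
      ih, Multiset.map_cons, Multiset.sum_cons, ite_mul, zero_mul, Finset.sum_ite_eq,
      Finset.mem_univ, if_true]
    congr 1
    -- Multiplication by `T p.2` moves the coefficient at `n - p.2` to `n`.
    exact (AddMonoidAlgebra.coeff_single_mul_apply (E p.1) 1 p.2 n).trans
      (by rw [one_mul, neg_add_eq_sub])

theorem TestSystem.exists_laurentPolynomial {A H : Type u} [CommRing A] [Ring H]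
    [Algebra A H] {ℋ : ℤ → Submodule A H} {F : Type u} [Field F] [Algebra A F] {ι : Type*}
    (t : TestSystem ℋ F ι) (W : GrModOver ℋ F) :
    ∃ D : ι → ℕ[T;T⁻¹], ∀ j n, (D j).coeff n = t.mult W j n := by
  obtain ⟨a, h, -⟩ := t.exists_labels W
  exact ⟨labelPoly a, fun j n => by rw [coeff_labelPoly, h]⟩

end LaurentPolynomial

/-! ### Existence and uniqueness of decomposition maps and matrices. -/

section DecompositionMap

variable {A H : Type u} [CommRing A] [Ring H] [Algebra A H] {ℋ : ℤ → Submodule A H}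
  [GradedAlgebra ℋ] [Module.Finite A H]
  {C K L : Type u} [CommRing C] [IsDomain C] [Algebra A C] [Field K] [Algebra A K] [Algebra C K]
  [IsScalarTower A C K] [IsFractionRing C K] [Field L] [Algebra A L] {σ : C →ₐ[A] L}

omit [IsDomain C] [IsFractionRing C K] in
theorem IsReduction.cp_eq (hC : IsIntegrallyClosedIn C K) {V : GrModOver ℋ K}
    {W W' : GrModOver ℋ L} (h : IsReduction σ V W) (h' : IsReduction σ V W') (x : H) (i : ℤ) :
    W.cp ((1 : L) ⊗ₜ[A] x) i = W'.cp ((1 : L) ⊗ₜ[A] x) i := by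
  obtain ⟨P, hP⟩ := V.exists_map_eq_cp hC x i
  rw [← h x i P hP, ← h' x i P hP]

omit [GradedAlgebra ℋ] [Module.Finite A H] [IsDomain C] [IsScalarTower A C K]
  [IsFractionRing C K] in
theorem IsReduction.shift {V : GrModOver ℋ K} {W : GrModOver ℋ L} (h : IsReduction σ V W)
    (n : ℤ) : IsReduction σ (V.shift n) (W.shift n) := fun x i P hP => by
  rw [GrMod.cp_shift] at hP ⊢
  exact h x _ P hP

omit [IsDomain C] in
-- Additivity of reduction without compatible lattices: the polynomials over `C` multiply, and the
-- direct sum of the two reductions has the product polynomials.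
theorem IsReduction.of_isExtension (hC : IsIntegrallyClosedIn C K) {V' V V'' : GrModOver ℋ K}
    (h : GrMod.IsExtension V' V V'') {W' W'' : GrModOver ℋ L} (h' : IsReduction σ V' W')
    (h'' : IsReduction σ V'' W'') : IsReduction σ V (W'.prod W'') := fun x i P hP => by
  obtain ⟨P', hP'⟩ := V'.exists_map_eq_cp hC x i
  obtain ⟨P'', hP''⟩ := V''.exists_map_eq_cp hC x i
  have : P = P' * P'' := Polynomial.map_injective _ (IsFractionRing.injective C K) (by
    rw [hP, Polynomial.map_mul, hP', hP'', h.cp_eq_mul])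
  rw [this, Polynomial.map_mul, h' x i P' hP', h'' x i P'' hP'',
    (GrMod.isExtension_prod W' W'').cp_eq_mul]

/-- Reduce a lattice in `V` to the residue field, then descend to `L`. -/
theorem exists_isReduction (hs : IsSplitAlgebra L (L ⊗[A] H))
    (hL : ∀ x : L, ∃ a b : A, algebraMap A L b ≠ 0 ∧ algebraMap A L b * x = algebraMap A L a)
    (σ : C →ₐ[A] L) (V : GrModOver ℋ K) : ∃ W : GrModOver ℋ L, IsReduction σ V W := by
  obtain ⟨ι, _, M, hM⟩ := exists_isGrIrrSystem ℋ L
  obtain ⟨t, -⟩ := hM.exists_testSystem hs hL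
  obtain ⟨s⟩ := ModularSystem.nonempty (K := K) σ fun x => by
    obtain ⟨a, b, h⟩ := hL x
    exact ⟨algebraMap A C a, algebraMap A C b, by simpa using h⟩
  obtain ⟨Λ, hΛ, e⟩ := GrMod.exists_lattice (O := s.O) V
  obtain ⟨W, hW⟩ := t.exists_descent s.k hs (Λ.baseChange s.k)
  refine ⟨W, fun x i P hP => Polynomial.map_injective _ (algebraMap L s.k).injective ?_⟩
  rw [hW, s.map_eq_cp Λ x i (hP.trans (e.cp_eq _ i).symm)]

/-- Existence and uniqueness of the graded decomposition map. -/
theorem exists_isGrDecompositionMap (hC : IsIntegrallyClosedIn C K)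
    (hs : IsSplitAlgebra L (L ⊗[A] H))
    (hL : ∀ x : L, ∃ a b : A, algebraMap A L b ≠ 0 ∧ algebraMap A L b * x = algebraMap A L a)
    (σ : C →ₐ[A] L) :
    ∃ d : GrK0Over ℋ K →+ GrK0Over ℋ L,
      (∀ V W, IsReduction σ V W → d (GrK0.cls V) = GrK0.cls W) ∧
      ∀ d', IsGrDecompositionMap ℋ σ d' ↔ d' = d := by
  obtain ⟨ι, _, M, hM⟩ := exists_isGrIrrSystem ℋ L
  obtain ⟨t, -⟩ := hM.exists_testSystem hs hL
  obtain ⟨s⟩ := ModularSystem.nonempty (K := K) σ fun x => by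
    obtain ⟨a, b, h⟩ := hL x
    exact ⟨algebraMap A C a, algebraMap A C b, by simpa using h⟩
  choose red hred using fun V : GrModOver ℋ K => exists_isReduction hs hL σ V
  have huniq : ∀ V W W', IsReduction σ V W → IsReduction σ V W' →
      GrK0.cls W = GrK0.cls W' := fun V W W' h h' =>
    t.cls_eq_of_cp fun x _ i => h.cp_eq hC h' x i
  let d : GrK0Over ℋ K →+ GrK0Over ℋ L := GrK0.lift (fun V => GrK0.cls (red V))
    fun V' V V'' h => by
      rw [← GrK0.cls_eq_add (GrMod.isExtension_prod (red V') (red V''))]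
      exact huniq V _ _ (hred V) (.of_isExtension hC h (hred V') (hred V''))
  have hd : ∀ V, d (GrK0.cls V) = GrK0.cls (red V) := fun V => GrK0.lift_cls _ _ V
  have hd' : ∀ V W, IsReduction σ V W → d (GrK0.cls V) = GrK0.cls W := fun V W h => by
    rw [hd, huniq V _ _ (hred V) h]
  have hdec : IsGrDecompositionMap ℋ σ d := by
    refine ⟨?_, fun j x => ?_, fun s Λ hΛ => ?_⟩
    · rintro _ ⟨V, rfl⟩
      exact ⟨red V, (hd V).symm⟩
    · have : d.comp (GrK0.qPow j) = (GrK0.qPow j).comp d := GrK0.hom_ext fun V => by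
        rw [AddMonoidHom.comp_apply, AddMonoidHom.comp_apply, GrK0.qPow_cls, hd V, GrK0.qPow_cls]
        exact hd' _ _ ((hred V).shift j)
      exact DFunLike.congr_fun this x
    · rw [hd, GrK0.baseChange, GrK0.lift_cls]
      refine (t.baseChange s.k hs).cls_eq_of_cp fun x _ i => ?_
      obtain ⟨P, hP⟩ := (Λ.baseChange K).exists_map_eq_cp hC x i
      rw [← s.map_eq_cp Λ x i hP, hred _ x i P hP, GrMod.cp_baseChange]
  refine ⟨d, hd', fun d' => ⟨fun h => GrK0.hom_ext fun V => ?_, fun h => h ▸ hdec⟩⟩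
  obtain ⟨Λ, hΛ, e⟩ := GrMod.exists_lattice (O := s.O) V
  -- Positivity makes `d' [V]` the class of a module, so it can be compared with `d [V]` after
  -- extension to the residue field.
  obtain ⟨W, hW⟩ := h.map_positive _ ⟨V, rfl⟩
  have h1 := h.reduction s Λ hΛ
  have h2 := hdec.reduction s Λ hΛ
  rw [e.cls_eq] at h1 h2
  rw [← hW] at h1 ⊢
  rw [hd] at h2 ⊢
  rw [GrK0.baseChange, GrK0.lift_cls] at h1 h2
  exact t.cls_eq_of_baseChange s.k hs (h1.trans h2.symm)

/-- Existence and uniqueness of the graded decomposition matrix. -/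
theorem exists_isGrDecompositionMatrix (hC : IsIntegrallyClosedIn C K)
    (hs : IsSplitAlgebra L (L ⊗[A] H))
    (hL : ∀ x : L, ∃ a b : A, algebraMap A L b ≠ 0 ∧ algebraMap A L b * x = algebraMap A L a)
    (σ : C →ₐ[A] L) {ιK ιL : Type*} (VK : ιK → GrModOver ℋ K) (t : TestSystem ℋ L ιL) :
    ∃ D : Matrix ιK ιL ℕ[T;T⁻¹],
      (∀ i W, IsReduction σ (VK i) W → ∀ j n, (D i j).coeff n = t.mult W j n) ∧
      ∀ D', IsGrDecompositionMatrix ℋ σ VK t.M D' ↔ D' = D := by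
  obtain ⟨s⟩ := ModularSystem.nonempty (K := K) σ fun x => by
    obtain ⟨a, b, h⟩ := hL x
    exact ⟨algebraMap A C a, algebraMap A C b, by simpa using h⟩
  choose red hred using fun V : GrModOver ℋ K => exists_isReduction hs hL σ V
  choose D hD using fun i => t.exists_laurentPolynomial (red (VK i))
  -- For every choice of `O` and lattice, the multiplicity is a root multiplicity of the image in
  -- `k` of one polynomial over `C`, and `red (VK i)` has the same image.
  have key : ∀ (s : ModularSystem A C K L σ) (i : ιK) (j : ιL) (Λ : GrModOver ℋ s.O),
      Module.Free s.O Λ.carrier → GrMod.Iso (Λ.baseChange K) (VK i) → ∀ (n : ℤ) (m : ℕ),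
        GrMod.IsGrMultiplicity (Λ.baseChange s.k) (((t.M j).shift n).baseChange s.k) m ↔
          m = (D i j).coeff n := fun s i j Λ hΛ e n m => by
    refine ((t.baseChange s.k hs).isGrMultiplicity_iff (j := j) (n := n)).trans ?_
    rw [hD, ← t.mult_baseChange s.k hs]
    obtain ⟨P, hP⟩ := (VK i).exists_map_eq_cp hC (t.elt j) (n + t.pos j)
    have h1 : (t.baseChange s.k hs).mult (Λ.baseChange s.k) j n =
        (t.baseChange s.k hs).mult ((red (VK i)).baseChange s.k) j n := by
      refine congrArg (Polynomial.rootMultiplicity _) ?_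
      refine (s.map_eq_cp Λ (t.elt j) (n + t.pos j) (hP.trans (e.cp_eq _ _).symm)).symm.trans ?_
      rw [hred (VK i) _ _ P hP, ← GrMod.cp_baseChange]
      rfl
    rw [h1]
  refine ⟨D, fun i W hW j n => ?_, fun D' => ⟨fun h => ?_, ?_⟩⟩
  · rw [hD, TestSystem.mult, (hred (VK i)).cp_eq hC hW, TestSystem.mult]
  · ext i j n
    obtain ⟨Λ, hΛ, e⟩ := GrMod.exists_lattice (O := s.O) (VK i)
    exact (key s i j Λ hΛ e n _).1 (h s i j Λ hΛ e n)
  · rintro rfl s i j Λ hΛ e n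
    exact (key s i j Λ hΛ e n _).2 rfl

end DecompositionMap

/-! ### Transitivity and the factorisation of decomposition matrices. -/

theorem exists_mul_eq_of_isFractionRing_range {A L : Type*} [CommRing A] [Field L] [Algebra A L]
    (h : IsFractionRing (algebraMap A L).range L) (x : L) :
    ∃ a b : A, algebraMap A L b ≠ 0 ∧ algebraMap A L b * x = algebraMap A L a := by
  obtain ⟨⟨⟨_, a, rfl⟩, ⟨⟨_, b, rfl⟩, hb⟩⟩, hx⟩ :=
    IsLocalization.surj (nonZeroDivisors (algebraMap A L).range) x
  refine ⟨a, b, fun h0 => nonZeroDivisors.ne_zero hb (Subtype.ext h0), ?_⟩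
  rw [mul_comm]
  exact hx

/-- The coefficients of the decomposition of a reduction of `V`, when the composition factors of
`V` are known. -/
theorem mult_reduction {A L L' H B : Type u} [CommRing A] [Field L] [Algebra A L] [Field L']
    [Algebra A L'] [Ring H] [Algebra A H] {ℋ : ℤ → Submodule A H} [CommRing B] [Algebra A B]
    [Algebra B L] {φ : B →ₐ[A] L'} {d : GrK0Over ℋ L →+ GrK0Over ℋ L'}
    (hd : ∀ V W, IsReduction φ V W → d (GrK0.cls V) = GrK0.cls W) {ι ι' : Type*} [Fintype ι]
    (t : TestSystem ℋ L ι) (t' : TestSystem ℋ L' ι') {U : ι → GrModOver ℋ L'}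
    (hU : ∀ j, IsReduction φ (t.M j) (U j)) {V : GrModOver ℋ L} {W : GrModOver ℋ L'}
    (hW : IsReduction φ V W) {D : ι → ℕ[T;T⁻¹]} (hD : ∀ j n, (D j).coeff n = t.mult V j n)
    {E : ι → ℕ[T;T⁻¹]} (j' : ι') (hE : ∀ j n, (E j).coeff n = t'.mult (U j) j' n) (n : ℤ) :
    (∑ j, D j * E j).coeff n = t'.mult W j' n := by
  obtain ⟨a, h1, h2, -⟩ := t.exists_labels V
  have hDa : D = labelPoly a := by
    ext j n
    rw [hD, coeff_labelPoly, h1]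
  let f : GrK0Over ℋ L' →+ ℤ := GrK0.lift (fun V => (t'.mult V j' n : ℤ)) fun V' V V'' h => by
    simp only [t'.mult_isExtension h, Nat.cast_add]
  have hf : ∀ V, f (GrK0.cls V) = t'.mult V j' n := fun V => GrK0.lift_cls _ _ V
  -- Expand `[V]` into shifted simple classes, apply `d`, and read off the multiplicity at `(j', n)`
  -- by the additive functional `f`.
  have h3 := congrArg (fun x => f (d x)) h2
  simp only [hd V W hW, hf, map_multiset_sum, Multiset.map_map] at h3
  rw [hDa, sum_labelPoly_mul]
  apply Nat.cast_injective (R := ℤ)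
  rw [h3, Nat.cast_multiset_sum, Multiset.map_map]
  refine congrArg _ (Multiset.map_congr rfl fun p _ => ?_)
  simp only [Function.comp_apply]
  rw [hd _ _ ((hU p.1).shift p.2), hf, t'.mult_shift, hE]

theorem mainTheorem2 {A K L L' H : Type u} [CommRing A] [IsDomain A] [IsIntegrallyClosed A]
    [Field K] [Algebra A K] [IsFractionRing A K]
    [Field L] [Algebra A L] [Field L'] [Algebra A L']
    [Ring H] [Algebra A H] [Module.Finite A H] [Module.Free A H]
    (ℋ : ℤ → Submodule A H) [GradedAlgebra ℋ]
    (hL : IsFractionRing (algebraMap A L).range L)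
    (hL' : IsFractionRing (algebraMap A L').range L')
    (hker : RingHom.ker (algebraMap A L) ≤ RingHom.ker (algebraMap A L'))
    (B : Subalgebra A L) (hB : IsIntegrallyClosedIn B L) (φ : B →ₐ[A] L')
    (hsplit : IsSplitAlgebra L (L ⊗[A] H)) (hsplit' : IsSplitAlgebra L' (L' ⊗[A] H)) :
    ∃ (dθ : GrK0Over ℋ K →+ GrK0Over ℋ L) (dθ' : GrK0Over ℋ K →+ GrK0Over ℋ L')
      (dφ : GrK0Over ℋ L →+ GrK0Over ℋ L'),
      (∀ d, IsGrDecompositionMap ℋ (Algebra.ofId A L) d ↔ d = dθ) ∧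
      (∀ d, IsGrDecompositionMap ℋ (Algebra.ofId A L') d ↔ d = dθ') ∧
      (∀ d, IsGrDecompositionMap ℋ φ d ↔ d = dφ) ∧
      dθ' = dφ.comp dθ ∧
      ∀ {ιK ιL ιL' : Type*} (VK : ιK → GrModOver ℋ K) (VL : ιL → GrModOver ℋ L)
        (VL' : ιL' → GrModOver ℋ L'),
        IsGrIrrSystem VK → IsGrIrrSystem VL → IsGrIrrSystem VL' →
        ∃ (Dθ : Matrix ιK ιL ℕ[T;T⁻¹]) (Dθ' : Matrix ιK ιL' ℕ[T;T⁻¹])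
          (Dφ : Matrix ιL ιL' ℕ[T;T⁻¹]),
          (∀ D, IsGrDecompositionMatrix ℋ (Algebra.ofId A L) VK VL D ↔ D = Dθ) ∧
          (∀ D, IsGrDecompositionMatrix ℋ (Algebra.ofId A L') VK VL' D ↔ D = Dθ') ∧
          (∀ D, IsGrDecompositionMatrix ℋ φ VL VL' D ↔ D = Dφ) ∧
          ∃ _ : Fintype ιL, Dθ' = Dθ * Dφ := by
  classical
  have hLA := exists_mul_eq_of_isFractionRing_range hL
  have hLA' := exists_mul_eq_of_isFractionRing_range hL'
  have hA : IsIntegrallyClosedIn A K := (isIntegrallyClosed_iff_isIntegrallyClosedIn K).1 ‹_›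
  -- Fractions with numerator and denominator in `θ(A)` already fill `L`, and `B` contains `θ(A)`.
  have hBL : IsFractionRing B L := IsFractionRing.of_field _ _ fun x => by
    obtain ⟨a, b, hb, hab⟩ := hLA x
    exact ⟨algebraMap A B a, algebraMap A B b, (eq_div_iff hb).2 ((mul_comm _ _).trans hab)⟩
  obtain ⟨dθ, hdθ, hθ⟩ := exists_isGrDecompositionMap (ℋ := ℋ) (K := K) hA hsplit hLA
    (Algebra.ofId A L)
  obtain ⟨dθ', hdθ', hθ'⟩ := exists_isGrDecompositionMap (ℋ := ℋ) (K := K) hA hsplit' hLA'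
    (Algebra.ofId A L')
  obtain ⟨dφ, hdφ, hφ⟩ := exists_isGrDecompositionMap (ℋ := ℋ) (K := L) hB hsplit' hLA' φ
  -- The heart of transitivity: the image in `B` of the polynomial `P` of `V` maps in `L` to that of
  -- `W`, so `φ` sends it to that of `U`. Since `φ ∘ θ = θ'`, this is `P` reduced by `θ'`.
  have htrans : ∀ (V : GrModOver ℋ K) (W : GrModOver ℋ L) (U : GrModOver ℋ L'),
      IsReduction (Algebra.ofId A L) V W → IsReduction φ W U →
        IsReduction (Algebra.ofId A L') V U := fun V W U hVW hWU x i P hP => by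
    have h1 := hVW x i P hP
    have h2 := hWU x i (P.map (algebraMap A B)) (by
      rw [← h1, Polynomial.map_map]; rfl)
    rw [← h2, Polynomial.map_map]
    congr 1
    exact RingHom.ext fun a => (φ.commutes a).symm
  refine ⟨dθ, dθ', dφ, hθ, hθ', hφ, GrK0.hom_ext fun V => ?_, ?_⟩
  · obtain ⟨W, hW⟩ := exists_isReduction hsplit hLA (Algebra.ofId A L) V
    obtain ⟨U, hU⟩ := exists_isReduction hsplit' hLA' φ W
    rw [AddMonoidHom.comp_apply, hdθ V W hW, hdφ W U hU, hdθ' V U (htrans V W U hW hU)]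
  · intro ιK ιL ιL' VK VL VL' hVK hVL hVL'
    have := hVL.finite
    have := Fintype.ofFinite ιL
    obtain ⟨t, rfl⟩ := hVL.exists_testSystem hsplit hLA
    obtain ⟨t', rfl⟩ := hVL'.exists_testSystem hsplit' hLA'
    obtain ⟨Dθ, hDθ, h1⟩ := exists_isGrDecompositionMatrix hA hsplit hLA (Algebra.ofId A L) VK t
    obtain ⟨Dθ', hDθ', h2⟩ :=
      exists_isGrDecompositionMatrix hA hsplit' hLA' (Algebra.ofId A L') VK t'
    obtain ⟨Dφ, hDφ, h3⟩ := exists_isGrDecompositionMatrix hB hsplit' hLA' φ t.M t'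
    refine ⟨Dθ, Dθ', Dφ, h1, h2, h3, inferInstance, ?_⟩
    choose U hU using fun j => exists_isReduction hsplit' hLA' φ (t.M j)
    ext i j' n
    obtain ⟨W, hW⟩ := exists_isReduction hsplit hLA (Algebra.ofId A L) (VK i)
    obtain ⟨W', hW'⟩ := exists_isReduction hsplit' hLA' φ W
    rw [hDθ' i W' (htrans _ _ _ hW hW'), Matrix.mul_apply]
    exact (mult_reduction hdφ t t' hU hW' (hDθ i W hW) j' (fun j n => hDφ j (U j) (hU j) j' n)
      n).symm
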